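/- Let $X$ be a real or complex Banach space that has a (Schauder) basis, and suppose that $\ell_1$ is isomorphic to a complemented subspace of $X$. Then $X$ has a semi-normalized basis $\mathcal B=(x_j)_{j=1}^\infty$, i.e. $0<\inf_j\|x_j\|\le\sup_j\|x_j\|<\infty$, with coordinate functionals $(x_j^*)_{j=1}^\infty$ and coordinate projections $S_A(f)=\sum_{j\in A}x_j^*(f)\,x_j$ ($A\subseteq\mathbb N$, whenever the sum is well defined), such that: (i) $\mathcal B$ is almost greedy: there is a constant $C$ such that $\|f-S_F(f)\|\le C\,\|f-S_A(f)\|$ whenever $f\in X$, $A,F\subseteq\mathbb N$, $|A|\le|F|<\infty$, and $|x_j^*(f)|\le|x_k^*(f)|$ for all $j\in\mathbb N\setminus F$ and $k\in F$; (ii) the fundamental function $\varphi_m=\sup\{\|\sum_{j\in A}x_j\| : A\subseteq\mathbb N,\ |A|\le m\}$ satisfies $\varphi_m\approx m$ for $m\ge1$, i.e. there are constants $0<c\le C<\infty$ with $c\,m\le\varphi_m\le C\,m$ for all $m\ge 1$; (iii) the constants $L_m=\sup\{\|S_A(f)\|/\|f\| : f\in X\setminus\{0\},\ x_j^*(f)=0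 \text{ for all } j>m,\ A\subseteq\mathbb N\}$ satisfy $L_m\approx\log m$ for $m\ge2$, i.e. there are constants $0<c\le C<\infty$ with $c\log m\le L_m\le C\log m$ for all $m\ge2$. -/

import Mathlib

open scoped ENNReal NNReal

/-- `α i ≲ β i` for `i ∈ I`, for families of (extended) non-negative reals: there is one finite
constant `C` with `α i ≤ C * β i` for all `i ∈ I`. -/
def Dominated {ι : Type*} (I : Set ι) (α β : ι → ℝ≥0∞) : Prop :=
  ∃ C : ℝ≥0, ∀ i ∈ I, α i ≤ (C : ℝ≥0∞) * β i

/-- `α i ≈ β i` for `i ∈ I`. When the `β i` are finite, this includes that the `α i` are finite. -/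
def EquivalentOn {ι : Type*} (I : Set ι) (α β : ι → ℝ≥0∞) : Prop :=
  Dominated I α β ∧ Dominated I β α

/-- `Y ≲_c X`: the space `Y` is isomorphic (linearly homeomorphic) to a complemented subspace
of `X`, i.e. to a subspace onto which there is a bounded linear projection of `X`. -/
def IsomorphicToComplemented (𝕜 Y X : Type*) [RCLike 𝕜]
    [NormedAddCommGroup Y] [NormedSpace 𝕜 Y] [NormedAddCommGroup X] [NormedSpace 𝕜 X] : Prop :=
  ∃ p : Submodule 𝕜 X, p.ClosedComplemented ∧ Nonempty (Y ≃L[𝕜] p)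

namespace SchauderBasis

variable {𝕜 X : Type*} [RCLike 𝕜] [NormedAddCommGroup X] [NormedSpace 𝕜 X]

/-- `0 < inf_j ‖x_j‖ ≤ sup_j ‖x_j‖ < ∞`. -/
def SemiNormalized (b : SchauderBasis 𝕜 X) : Prop :=
  ∃ c C : ℝ, 0 < c ∧ ∀ j : ℕ, c ≤ ‖b j‖ ∧ ‖b j‖ ≤ C

/-- The finite set `F` is a greedy set of `f`: no coefficient of `f` outside `F` exceeds in
modulus a coefficient of `f` inside `F`. -/
def IsGreedySet (b : SchauderBasis 𝕜 X) (f : X) (F : Finset ℕ) : Prop :=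
  ∀ j ∉ F, ∀ k ∈ F, ‖b.coord j f‖ ≤ ‖b.coord k f‖

/-- The basis is almost greedy: `‖f - S_F(f)‖ ≤ C ‖f - S_A(f)‖` whenever `F` is a (finite) greedy
set of `f` and `|A| ≤ |F|`. Here `S_A` is the coordinate projection on `A`. -/
def AlmostGreedy (b : SchauderBasis 𝕜 X) : Prop :=
  ∃ C : ℝ, ∀ (f : X) (F A : Finset ℕ), b.IsGreedySet f F → A.card ≤ F.card →
    ‖f - GeneralSchauderBasis.proj b F f‖ ≤ C * ‖f - GeneralSchauderBasis.proj b A f‖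

/-- The fundamental function `φ_m = sup { ‖∑_{j ∈ A} x_j‖ : |A| ≤ m }`. -/
noncomputable def fundamentalFunction (b : SchauderBasis 𝕜 X) (m : ℕ) : ℝ≥0∞ :=
  ⨆ (A : Finset ℕ) (_ : A.card ≤ m), ‖∑ j ∈ A, b j‖ₑ

/-- `L_m = sup { ‖S_A(f)‖ / ‖f‖ : f ≠ 0, supp f ⊆ {first m indices}, A ⊆ ℕ }`. The indices start
from `0`, so the first `m` of them are those `< m`. Since such an `f` has finite support, `S_A(f)`
is the same for `A` and for its finite subset of indices `< m`, so that it is enough to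
take finite sets `A`. -/
noncomputable def condConst (b : SchauderBasis 𝕜 X) (m : ℕ) : ℝ≥0∞ :=
  ⨆ (f : X) (_ : f ≠ 0) (_ : ∀ j : ℕ, b.coord j f ≠ 0 → j < m) (A : Finset ℕ),
    ‖GeneralSchauderBasis.proj b A f‖ₑ / ‖f‖ₑ

end SchauderBasis

/-! Since `ℓ₁ ≃ ℓ₁ × ℓ₁`, a complemented copy of `ℓ₁` gives `X ≃ X × ℓ₁ ≃ (X × ℓ₁) × ℓ₁`. The factor
`X × ℓ₁` gets a semi-normalized basis `v` interlacing a normalized basis of `X` with the differences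
`e_k - e_{k-1}` of `ℓ₁`. These are highly conditional: the sum of the first `k` of them telescopes
to norm one, while the sum of `k` even-indexed ones has norm at least `k`.

The other factor `ℓ₁` serves to spread `v` out. On the `n`-th dyadic block, `v n` and `2 ^ (n + 1) -
1` unit vectors `e j` are replaced by `x j = v n + e j - avg`, where `e j = 0` at the first index
and `avg` is the mean of the other `e j`. Then `v n` is the mean of the `x j` over the non-initial
indices, and the coefficients of `f` are a sequence of size `O(‖f‖ / j)` plus one of `ℓ₁` norm
`O(‖f‖)`. This is `HarmonicBound`. It puts the coefficients in weak `ℓ₁`, whence `φ_m ≈ m`; it makes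
greedy projections comparable with partial sums, whence almost greediness; and the harmonic sum
yields `L_m ≲ log m`.

For the reverse bound, the first `K` blocks occupy fewer than `2 ^ (K + 1)` indices, so that
conditionality of `v` linear in `K` becomes logarithmic in the index (`le_condConst_of_sum_block`).
-/

namespace SchauderBasis

open Filter Topology

/-! ### Biorthogonal systems and conditionality constants -/

section

variable {𝕜 X : Type*} [RCLike 𝕜] [NormedAddCommGroup X] [NormedSpace 𝕜 X]

/-- A biorthogonal system whose partial sum operators are uniformly bounded and whose vectors
have dense linear span is a Schauder basis. -/
theorem exists_of_biorthogonal (x : ℕ → X) (a : ℕ → StrongDual 𝕜 X)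
    (ortho : ∀ i j, a i (x j) = if i = j then 1 else 0) (C : ℝ)
    (bound : ∀ m f, ‖∑ j ∈ Finset.range m, a j f • x j‖ ≤ C * ‖f‖)
    (dense : ∀ f, f ∈ (Submodule.span 𝕜 (Set.range x)).topologicalClosure) :
    ∃ b : SchauderBasis 𝕜 X, b.basis = x ∧ b.coord = a := by
  have hC : 0 ≤ C ∨ ∀ f : X, f = 0 := by
    by_cases h : ∃ f : X, f ≠ 0
    · obtain ⟨f, hf⟩ := h
      have := (norm_nonneg _).trans (bound 0 f)
      exact Or.inl (nonneg_of_mul_nonneg_left this (norm_pos_iff.2 hf))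
    · exact Or.inr (by simpa using h)
  have key : ∀ f, Tendsto (fun m => ∑ j ∈ Finset.range m, a j f • x j) atTop (𝓝 f) := by
    rcases hC with hC | hX
    swap
    · intro f
      rw [hX f]
      exact tendsto_const_nhds.congr fun m => (hX _).symm
    have hspan : ∀ g ∈ Submodule.span 𝕜 (Set.range x),
        ∀ᶠ m in atTop, ∑ j ∈ Finset.range m, a j g • x j = g := by
      intro g hg
      induction hg using Submodule.span_induction with
      | mem y hy =>
        obtain ⟨i, rfl⟩ := hy
        filter_upwards [eventually_gt_atTop i] with m hm
        simp [ortho, hm]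
      | zero => simp
      | add y z _ _ hy hz =>
        filter_upwards [hy, hz] with m h1 h2
        simp only [map_add, add_smul, Finset.sum_add_distrib, h1, h2]
      | smul c y _ hy =>
        filter_upwards [hy] with m h1
        simp only [map_smul, smul_eq_mul, mul_smul, ← Finset.smul_sum, h1]
    intro f
    rw [Metric.tendsto_atTop]
    intro ε hε
    have hf := dense f
    rw [← SetLike.mem_coe, Submodule.topologicalClosure_coe, Metric.mem_closure_iff] at hf
    obtain ⟨g, hg, hfg⟩ := hf (ε / (C + 1)) (by positivity)
    obtain ⟨M, hM⟩ := eventually_atTop.1 (hspan g hg)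
    refine ⟨M, fun m hm => ?_⟩
    -- The partial sums eventually reproduce `g` exactly, so only the error at `f - g` remains.
    have h1 : ∑ j ∈ Finset.range m, a j f • x j - f
        = ∑ j ∈ Finset.range m, a j (f - g) • x j - (f - g) := by
      simp only [map_sub, sub_smul, Finset.sum_sub_distrib, hM m hm]
      abel
    rw [dist_eq_norm] at hfg ⊢
    rw [h1]
    calc _ ≤ C * ‖f - g‖ + ‖f - g‖ := (norm_sub_le _ _).trans (by gcongr; exact bound _ _)
      _ = (C + 1) * ‖f - g‖ := by ring
      _ < (C + 1) * (ε / (C + 1)) := by gcongr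
      _ = ε := by field_simp
  refine ⟨⟨x, a, fun i j => ?_, fun f => ?_⟩, rfl, rfl⟩
  · rw [ortho]
    split_ifs with h
    · subst h; simp
    · simp [h]
  · rw [HasSum, SummationFilter.conditional_filter_eq_map_range, tendsto_map'_iff]
    exact key f

variable (b : SchauderBasis 𝕜 X)

theorem coord_basis (i j : ℕ) : b.coord i (b j) = if i = j then 1 else 0 := by
  rw [b.ortho]
  split_ifs with h
  · subst h; simp
  · simp [h]

theorem coord_proj (A : Finset ℕ) (f : X) (i : ℕ) :
    b.coord i (GeneralSchauderBasis.proj b A f) = if i ∈ A then b.coord i f else 0 := by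
  simp [coord_basis]

theorem eq_zero_of_coord_eq_zero {f : X} (h : ∀ j, b.coord j f = 0) : f = 0 := by
  have h1 := b.tendsto_proj f
  simp only [proj_apply, h, zero_smul, Finset.sum_const_zero] at h1
  exact tendsto_nhds_unique h1 tendsto_const_nhds |>.symm ▸ rfl

theorem condConst_mono {m n : ℕ} (h : m ≤ n) : b.condConst m ≤ b.condConst n := by
  refine iSup₂_le fun f hf => iSup_le fun hs => iSup_le fun A => ?_
  refine le_iSup₂_of_le f hf (le_iSup₂_of_le (fun j hj => (hs j hj).trans_le h) A le_rfl)

theorem one_le_condConst {m : ℕ} (hm : 1 ≤ m) : 1 ≤ b.condConst m := by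
  have h0 : b 0 ≠ 0 := fun h => by simpa [h] using b.coord_basis 0 0
  refine le_iSup₂_of_le (b 0) h0 (le_iSup₂_of_le (fun j hj => ?_) {0} ?_)
  · rw [coord_basis] at hj
    have : j = 0 := by by_contra h; simp [h] at hj
    omega
  · have : GeneralSchauderBasis.proj b {0} (b 0) = b 0 := by simp [coord_basis]
    rw [this, ENNReal.div_self (by simpa using h0) (by simp)]

/-- By monotonicity a sparse sequence of indices suffices: `2 ^ (4 * k + 1) ≤ m ≤ 2 ^ (4 * k + 5)`
gives `log m ≤ 4 * k + 5`. The summand `5` is absorbed by `L_m ≥ 1`. -/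
theorem log_dominated_condConst {δ : ℝ} (hδ : 0 < δ)
    (h : ∀ k : ℕ, ENNReal.ofReal (δ * k) ≤ b.condConst (2 ^ (4 * k + 1))) :
    Dominated {m : ℕ | 2 ≤ m} (fun m => ENNReal.ofReal (Real.log m)) b.condConst := by
  refine ⟨5 + 4 / δ.toNNReal, fun m hm => ?_⟩
  have hm : 2 ≤ m := hm
  set k := (Nat.log 2 m - 1) / 4 with hk
  have hlog1 : 1 ≤ Nat.log 2 m := Nat.le_log_of_pow_le (by norm_num) (by simpa)
  have h1 : 2 ^ (4 * k + 1) ≤ m :=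
    (Nat.pow_le_pow_right (by norm_num) (by omega)).trans (Nat.pow_log_le_self 2 (by omega))
  have h2 : (m : ℝ) ≤ 2 ^ (4 * k + 5) := by
    have := (Nat.lt_pow_succ_log_self (by norm_num : 1 < 2) m).le.trans
      (Nat.pow_le_pow_right (n := 2) (by norm_num) (by omega : _ ≤ 4 * k + 5))
    exact_mod_cast this
  have h3 : Real.log m ≤ 5 + 4 / δ * (δ * k) := by
    have hm0 : (0 : ℝ) < m := by positivity
    calc Real.log m ≤ Real.log (2 ^ (4 * k + 5)) := Real.log_le_log hm0 h2
      _ = (4 * k + 5) * Real.log 2 := by rw [Real.log_pow]; push_cast; ring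
      _ ≤ (4 * k + 5) * 1 := by
        gcongr
        linarith [Real.log_le_sub_one_of_pos (by norm_num : (0 : ℝ) < 2)]
      _ = 5 + 4 / δ * (δ * k) := by field_simp; ring
  have hL := (h k).trans (b.condConst_mono h1)
  have hL1 := b.one_le_condConst (by omega : 1 ≤ m)
  have hδ' : ENNReal.ofReal (4 / δ) = ((4 / δ.toNNReal : ℝ≥0) : ℝ≥0∞) := by
    rw [ENNReal.ofReal, Real.toNNReal_div (by norm_num)]
    simp
  calc ENNReal.ofReal (Real.log m) ≤ ENNReal.ofReal (5 + 4 / δ * (δ * k)) :=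
        ENNReal.ofReal_le_ofReal h3
    _ = 5 * 1 + ENNReal.ofReal (4 / δ) * ENNReal.ofReal (δ * k) := by
      rw [ENNReal.ofReal_add (by norm_num) (by positivity), ENNReal.ofReal_mul (by positivity)]
      simp
    _ ≤ 5 * b.condConst m + ENNReal.ofReal (4 / δ) * b.condConst m := by gcongr
    _ = _ := by rw [hδ', ENNReal.coe_add, add_mul]; simp

/-! ### Consequences of the harmonic bound -/

/-- The basis is bounded, and the coefficients of every vector differ from a sequence of size
`O(1 / j)` by an absolutely summable sequence, both controlled by the norm of the vector. -/
structure HarmonicBound (b : SchauderBasis 𝕜 X) (C : ℝ) : Prop where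
  norm_le : ∀ j, ‖b j‖ ≤ C
  exists_approx : ∀ f : X, ∃ c : ℕ → 𝕜, (∀ j : ℕ, (j + 1) * ‖c j‖ ≤ C * ‖f‖) ∧
    ∀ A : Finset ℕ, ∑ j ∈ A, ‖b.coord j f - c j‖ ≤ C * ‖f‖

namespace HarmonicBound

variable {b : SchauderBasis 𝕜 X} {C : ℝ} (h : HarmonicBound b C)
include h

theorem nonneg : 0 ≤ C := (norm_nonneg _).trans (h.norm_le 0)

/-- A weak `ℓ₁` estimate. Where a coefficient is at least `α`, either `‖c j‖ ≥ α / 2`, which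
confines `j` to an initial segment, or the summable part exceeds `α / 2`, and Markov's inequality
counts such indices. -/
theorem mul_card_le {α : ℝ} (f : X) (G : Finset ℕ)
    (hG : ∀ j ∈ G, α ≤ ‖b.coord j f‖) : α * G.card ≤ 4 * C * ‖f‖ := by
  obtain ⟨c, hc, hs⟩ := h.exists_approx f
  have hC := h.nonneg
  have hCf : 0 ≤ C * ‖f‖ := by positivity
  have h1 : α * (G.filter fun j => α ≤ 2 * ‖c j‖).card ≤ 2 * (C * ‖f‖) := by
    rcases (G.filter fun j => α ≤ 2 * ‖c j‖).eq_empty_or_nonempty with he | hne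
    · simp [he, hCf]
    · set k := (G.filter fun j => α ≤ 2 * ‖c j‖).max' hne with hk
      have hk1 := Finset.max'_mem _ hne
      rw [← hk, Finset.mem_filter] at hk1
      have hcard : (G.filter fun j => α ≤ 2 * ‖c j‖).card ≤ k + 1 := by
        rw [← Finset.card_range (k + 1)]
        refine Finset.card_le_card fun j hj => ?_
        have := Finset.le_max' _ j hj
        exact Finset.mem_range.2 (by omega)
      have hcard' : ((G.filter fun j => α ≤ 2 * ‖c j‖).card : ℝ) ≤ k + 1 := by exact_mod_cast hcard
      calc α * (G.filter fun j => α ≤ 2 * ‖c j‖).card ≤ (2 * ‖c k‖) * (k + 1) := by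
            gcongr
            exact hk1.2
        _ = 2 * ((k + 1) * ‖c k‖) := by ring
        _ ≤ _ := mul_le_mul_of_nonneg_left (hc k) zero_le_two
  have h2 : α * (G.filter fun j => ¬ α ≤ 2 * ‖c j‖).card ≤ 2 * (C * ‖f‖) := by
    calc α * (G.filter fun j => ¬ α ≤ 2 * ‖c j‖).card
        = ∑ j ∈ G.filter fun j => ¬ α ≤ 2 * ‖c j‖, α := by simp [mul_comm]
      _ ≤ ∑ j ∈ G.filter fun j => ¬ α ≤ 2 * ‖c j‖, 2 * ‖b.coord j f - c j‖ := by
        refine Finset.sum_le_sum fun j hj => ?_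
        rw [Finset.mem_filter] at hj
        have := norm_sub_norm_le (b.coord j f) (c j)
        have := hG j hj.1
        linarith [hj.2]
      _ ≤ _ := by
        rw [← Finset.mul_sum]
        gcongr
        exact hs _
  have h3 : (G.card : ℝ) = (G.filter fun j => α ≤ 2 * ‖c j‖).card
      + (G.filter fun j => ¬ α ≤ 2 * ‖c j‖).card := by
    exact_mod_cast (Finset.card_filter_add_card_filter_not _).symm
  rw [h3]
  linarith

theorem norm_sum_le (A : Finset ℕ) (a : ℕ → 𝕜) :
    ‖∑ j ∈ A, a j • b j‖ ≤ C * ∑ j ∈ A, ‖a j‖ := by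
  rw [Finset.mul_sum]
  refine norm_sum_le_of_le _ fun j _ => ?_
  rw [norm_smul, mul_comm]
  gcongr
  exact h.norm_le j

theorem semiNormalized : b.SemiNormalized := by
  have hC := h.nonneg
  refine ⟨(4 * C + 1)⁻¹, C, by positivity, fun j => ⟨?_, h.norm_le j⟩⟩
  have := h.mul_card_le (α := 1) (b j) {j} (by simp [coord_basis])
  rw [Finset.card_singleton, Nat.cast_one] at this
  rw [inv_le_iff_one_le_mul₀ (by positivity)]
  linarith [norm_nonneg (b j)]

/-- The projection is compared with the partial sum of length `M ≈ 2 * C * ‖f‖ / α`. Below `M`, the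
omitted coefficients are at most `α`, with total at most `α * M`. From `M` on, `‖c j‖ < α / 2`, so
the selected coefficients are at most twice their summable parts. -/
theorem norm_proj_greedy_le {K : ℝ} (hK : ∀ n, ‖b.proj n‖ ≤ K) {α : ℝ} (hα : 0 < α) (f : X)
    (G : Finset ℕ) (hG : ∀ j ∈ G, α ≤ ‖b.coord j f‖) (hG' : ∀ j ∉ G, ‖b.coord j f‖ ≤ α) :
    ‖GeneralSchauderBasis.proj b G f‖ ≤ (K + 4 * C ^ 2) * ‖f‖ := by
  obtain ⟨c, hc, hs⟩ := h.exists_approx f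
  have hC := h.nonneg
  have hCf : 0 ≤ C * ‖f‖ := by positivity
  set M := ⌊2 * C * ‖f‖ / α⌋₊ with hM
  have hM1 : α * M ≤ 2 * (C * ‖f‖) := by
    have := Nat.floor_le (show 0 ≤ 2 * C * ‖f‖ / α by positivity)
    rw [← hM, le_div_iff₀ hα] at this
    linarith
  have hM2 : ∀ j, M ≤ j → 2 * ‖c j‖ < α := by
    intro j hj
    have h1 := Nat.lt_floor_add_one (2 * C * ‖f‖ / α)
    rw [← hM, div_lt_iff₀ hα] at h1
    have h2 : (M : ℝ) ≤ j := by exact_mod_cast hj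
    have h3 := hc j
    by_contra! h4
    have h5 : ((M : ℝ) + 1) * α ≤ (j + 1) * (2 * ‖c j‖) := by gcongr
    linarith
  have hsplit : GeneralSchauderBasis.proj b G f = b.proj M f
      - ∑ j ∈ Finset.range M \ G, b.coord j f • b j
      + ∑ j ∈ G \ Finset.range M, b.coord j f • b j := by
    simp only [GeneralSchauderBasis.proj_apply, proj_apply]
    rw [← Finset.sum_inter_add_sum_sdiff G (Finset.range M),
      ← Finset.sum_inter_add_sum_sdiff (Finset.range M) G, Finset.inter_comm]
    abel
  have h1 : ‖b.proj M f‖ ≤ K * ‖f‖ := (b.proj M).le_of_opNorm_le (hK M) f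
  have h2 : ‖∑ j ∈ Finset.range M \ G, b.coord j f • b j‖ ≤ C * (2 * (C * ‖f‖)) := by
    refine (h.norm_sum_le _ _).trans ?_
    gcongr
    calc ∑ j ∈ Finset.range M \ G, ‖b.coord j f‖ ≤ ∑ j ∈ Finset.range M \ G, α :=
          Finset.sum_le_sum fun j hj => hG' j (Finset.mem_sdiff.1 hj).2
      _ ≤ ∑ j ∈ Finset.range M, α :=
          Finset.sum_le_sum_of_subset_of_nonneg Finset.sdiff_subset fun _ _ _ => hα.le
      _ = α * M := by simp [mul_comm]
      _ ≤ _ := hM1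
  have h3 : ‖∑ j ∈ G \ Finset.range M, b.coord j f • b j‖ ≤ C * (2 * (C * ‖f‖)) := by
    refine (h.norm_sum_le _ _).trans ?_
    gcongr
    calc ∑ j ∈ G \ Finset.range M, ‖b.coord j f‖
        ≤ ∑ j ∈ G \ Finset.range M, 2 * ‖b.coord j f - c j‖ := by
          refine Finset.sum_le_sum fun j hj => ?_
          rw [Finset.mem_sdiff, Finset.mem_range, not_lt] at hj
          have := norm_sub_norm_le (b.coord j f) (c j)
          linarith [hM2 j hj.2, hG j hj.1]
      _ ≤ _ := by
        rw [← Finset.mul_sum]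
        gcongr
        exact hs _
  rw [hsplit]
  calc _ ≤ ‖b.proj M f‖ + ‖∑ j ∈ Finset.range M \ G, b.coord j f • b j‖
        + ‖∑ j ∈ G \ Finset.range M, b.coord j f • b j‖ :=
        (norm_add_le _ _).trans (by gcongr; exact norm_sub_le _ _)
    _ ≤ K * ‖f‖ + C * (2 * (C * ‖f‖)) + C * (2 * (C * ‖f‖)) := by gcongr
    _ = _ := by ring

/-- With `g = f - S_A f`, one has `f - S_F f = g - S_{F \ A} g + S_{A \ F} f`. The set `F \ A` is
greedy for `g`. On `A \ F` the coefficients are at most the least one on `F \ A`, and `|A \ F| ≤ |F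
\ A|`, so the weak `ℓ₁` estimate for `g` bounds the last term. -/
theorem almostGreedy [CompleteSpace X] : b.AlmostGreedy := by
  obtain ⟨K, hK⟩ := b.exists_norm_proj_le
  have hC := h.nonneg
  have hK0 : 0 ≤ K := (norm_nonneg _).trans (hK 0)
  refine ⟨1 + (K + 4 * C ^ 2) + C * (4 * C), fun f F A hF hcard => ?_⟩
  set g := f - GeneralSchauderBasis.proj b A f with hg
  have hgc : ∀ j, b.coord j g = if j ∈ A then 0 else b.coord j f := by
    intro j
    rw [hg, map_sub, coord_proj]
    split_ifs <;> simp
  have hcard' : (A \ F).card ≤ (F \ A).card := by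
    have h1 := Finset.card_sdiff_add_card_inter A F
    have h2 := Finset.card_sdiff_add_card_inter F A
    rw [Finset.inter_comm] at h2
    omega
  rcases (F \ A).eq_empty_or_nonempty with he | hne
  · have hAF : A = F := by
      rw [he, Finset.card_empty, Nat.le_zero, Finset.card_eq_zero,
        Finset.sdiff_eq_empty_iff_subset] at hcard'
      exact hcard'.antisymm (Finset.sdiff_eq_empty_iff_subset.1 he)
    rw [← hAF, ← hg]
    exact le_mul_of_one_le_left (norm_nonneg _) (by nlinarith [sq_nonneg C])
  obtain ⟨k, hk, hmin⟩ := Finset.exists_min_image (F \ A) (fun j => ‖b.coord j f‖) hne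
  have hkF := (Finset.mem_sdiff.1 hk).1
  -- If the threshold is zero, all coefficients outside `F` vanish and `f = S_F f`.
  rcases (norm_nonneg (b.coord k f)).eq_or_lt with h0 | hpos
  · have : f - GeneralSchauderBasis.proj b F f = 0 := by
      refine b.eq_zero_of_coord_eq_zero fun j => ?_
      rw [map_sub, coord_proj]
      split_ifs with hj
      · simp
      · have := hF j hj k hkF
        rw [← h0] at this
        simpa using this
    rw [this, norm_zero]
    positivity
  · have hG : ∀ j ∈ F \ A, ‖b.coord k f‖ ≤ ‖b.coord j g‖ := fun j hj => by
      rw [hgc, if_neg (Finset.mem_sdiff.1 hj).2]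
      exact hmin j hj
    have hG' : ∀ j ∉ F \ A, ‖b.coord j g‖ ≤ ‖b.coord k f‖ := fun j hj => by
      rw [hgc]
      split_ifs with hjA
      · simp
      · exact hF j (fun hjF => hj (Finset.mem_sdiff.2 ⟨hjF, hjA⟩)) k hkF
    have h1 := h.norm_proj_greedy_le hK hpos g (F \ A) hG hG'
    have h2 := h.mul_card_le g (F \ A) hG
    have h3 : ‖∑ j ∈ A \ F, b.coord j f • b j‖ ≤ C * (4 * C * ‖g‖) := by
      refine (h.norm_sum_le _ _).trans ?_
      gcongr
      calc ∑ j ∈ A \ F, ‖b.coord j f‖ ≤ ∑ j ∈ A \ F, ‖b.coord k f‖ :=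
            Finset.sum_le_sum fun j hj => hF j (Finset.mem_sdiff.1 hj).2 k hkF
        _ = ‖b.coord k f‖ * (A \ F).card := by simp [mul_comm]
        _ ≤ ‖b.coord k f‖ * (F \ A).card := by gcongr
        _ ≤ _ := h2
    have hproj : GeneralSchauderBasis.proj b (F \ A) g = ∑ j ∈ F \ A, b.coord j f • b j := by
      rw [GeneralSchauderBasis.proj_apply]
      refine Finset.sum_congr rfl fun j hj => ?_
      rw [hgc, if_neg (Finset.mem_sdiff.1 hj).2]
    have hsplit : f - GeneralSchauderBasis.proj b F f
        = g - GeneralSchauderBasis.proj b (F \ A) g + ∑ j ∈ A \ F, b.coord j f • b j := by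
      rw [hproj, hg]
      simp only [GeneralSchauderBasis.proj_apply]
      rw [← Finset.sum_inter_add_sum_sdiff F A, ← Finset.sum_inter_add_sum_sdiff A F,
        Finset.inter_comm]
      abel
    rw [hsplit]
    calc _ ≤ ‖g‖ + ‖GeneralSchauderBasis.proj b (F \ A) g‖
          + ‖∑ j ∈ A \ F, b.coord j f • b j‖ :=
          (norm_add_le _ _).trans (by gcongr; exact norm_sub_le _ _)
      _ ≤ ‖g‖ + (K + 4 * C ^ 2) * ‖g‖ + C * (4 * C * ‖g‖) := by gcongr
      _ = _ := by ring

theorem fundamentalFunction_equivalent (I : Set ℕ) :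
    EquivalentOn I b.fundamentalFunction (fun m => (m : ℝ≥0∞)) := by
  have hC := h.nonneg
  constructor
  · refine ⟨C.toNNReal, fun m _ => iSup₂_le fun A hA => ?_⟩
    have h1 : ‖∑ j ∈ A, b j‖ ≤ C * m := by
      have := h.norm_sum_le A (fun _ => (1 : 𝕜))
      simp only [one_smul, norm_one, Finset.sum_const, nsmul_eq_mul, mul_one] at this
      refine this.trans ?_
      gcongr
    rw [← ofReal_norm]
    refine (ENNReal.ofReal_le_ofReal h1).trans_eq ?_
    rw [ENNReal.ofReal_mul hC, ENNReal.ofReal_natCast]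
    rfl
  · refine ⟨(4 * C).toNNReal, fun m _ => ?_⟩
    have h1 : (m : ℝ) ≤ 4 * C * ‖∑ j ∈ Finset.range m, b j‖ := by
      have := h.mul_card_le (α := 1) (∑ j ∈ Finset.range m, b j) (Finset.range m) fun j hj => by
        have : b.coord j (∑ j ∈ Finset.range m, b j) = 1 := by
          simp only [map_sum, coord_basis, Finset.sum_ite_eq, hj, if_true]
        simp [this]
      simpa using this
    calc (m : ℝ≥0∞) = ENNReal.ofReal m := (ENNReal.ofReal_natCast m).symm
      _ ≤ ENNReal.ofReal (4 * C * ‖∑ j ∈ Finset.range m, b j‖) := ENNReal.ofReal_le_ofReal h1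
      _ = (4 * C).toNNReal * ‖∑ j ∈ Finset.range m, b j‖ₑ := by
        rw [ENNReal.ofReal_mul (by positivity), ofReal_norm]
        rfl
      _ ≤ _ := by
        gcongr
        exact le_iSup₂_of_le (Finset.range m) (by simp) le_rfl

theorem condConst_dominated_log :
    Dominated {m : ℕ | 2 ≤ m} b.condConst (fun m => ENNReal.ofReal (Real.log m)) := by
  have hC := h.nonneg
  -- The factor `2 / log 2 + 1` turns `2 + log m` into a multiple of `log m`, for `m ≥ 2`.
  refine ⟨(C ^ 2 * (2 / Real.log 2 + 1)).toNNReal, fun m hm => ?_⟩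
  have hm : 2 ≤ m := hm
  have hlog2 : 0 < Real.log 2 := Real.log_pos (by norm_num)
  have hlog : Real.log 2 ≤ Real.log m := Real.log_le_log (by norm_num) (by exact_mod_cast hm)
  refine iSup₂_le fun f hf => iSup_le fun hs => iSup_le fun A => ?_
  obtain ⟨c, hc, hsum⟩ := h.exists_approx f
  have h1 : ‖GeneralSchauderBasis.proj b A f‖ ≤ C * ∑ j ∈ Finset.range m, ‖b.coord j f‖ := by
    rw [GeneralSchauderBasis.proj_apply]
    refine (h.norm_sum_le _ _).trans (mul_le_mul_of_nonneg_left ?_ hC)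
    rw [← Finset.sum_filter_add_sum_filter_not A (· < m)]
    have : ∑ j ∈ A with ¬ j < m, ‖b.coord j f‖ = 0 := by
      refine Finset.sum_eq_zero fun j hj => ?_
      rw [Finset.mem_filter] at hj
      have : b.coord j f = 0 := by
        by_contra h0
        exact hj.2 (hs j h0)
      simp [this]
    rw [this, add_zero]
    refine Finset.sum_le_sum_of_subset_of_nonneg (fun j hj => ?_) fun _ _ _ => norm_nonneg _
    simpa using (Finset.mem_filter.1 hj).2
  have h2 : ∑ j ∈ Finset.range m, ‖b.coord j f‖ ≤ C * ‖f‖ * (2 + Real.log m) := by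
    have hharm : ∑ j ∈ Finset.range m, ((j : ℝ) + 1)⁻¹ ≤ 1 + Real.log m := by
      have := harmonic_le_one_add_log m
      simpa [harmonic] using this
    calc ∑ j ∈ Finset.range m, ‖b.coord j f‖
        ≤ ∑ j ∈ Finset.range m, (‖b.coord j f - c j‖ + C * ‖f‖ * ((j : ℝ) + 1)⁻¹) := by
          refine Finset.sum_le_sum fun j _ => ?_
          have h3 : ‖c j‖ ≤ C * ‖f‖ * ((j : ℝ) + 1)⁻¹ := by
            rw [← div_eq_mul_inv, le_div_iff₀ (by positivity), mul_comm]
            exact hc j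
          have := norm_sub_norm_le (b.coord j f) (c j)
          linarith
      _ ≤ C * ‖f‖ + C * ‖f‖ * (1 + Real.log m) := by
        rw [Finset.sum_add_distrib, ← Finset.mul_sum]
        gcongr
        exact hsum _
      _ = _ := by ring
  have h3 : ‖GeneralSchauderBasis.proj b A f‖
      ≤ C ^ 2 * (2 / Real.log 2 + 1) * Real.log m * ‖f‖ := by
    have h4 : 2 + Real.log m ≤ (2 / Real.log 2 + 1) * Real.log m := by
      have : 2 ≤ 2 / Real.log 2 * Real.log m := by
        rw [div_mul_eq_mul_div, le_div_iff₀ hlog2]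
        gcongr
      linarith
    calc _ ≤ C * (C * ‖f‖ * (2 + Real.log m)) := h1.trans (by gcongr)
      _ ≤ C * (C * ‖f‖ * ((2 / Real.log 2 + 1) * Real.log m)) := by gcongr
      _ = _ := by ring
  refine ENNReal.div_le_of_le_mul ?_
  rw [← ofReal_norm, ← ofReal_norm]
  refine (ENNReal.ofReal_le_ofReal h3).trans_eq ?_
  rw [ENNReal.ofReal_mul (mul_nonneg (by positivity) (hlog2.le.trans hlog)),
    ENNReal.ofReal_mul (by positivity)]
  rfl

end HarmonicBound
end

/-! ### Dyadic blocks and their weights -/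

/-- The first index of the `n`-th dyadic block. -/
def blockStart (n : ℕ) : ℕ := 2 ^ (n + 1) - 2

/-- The dyadic blocks, of length `2 ^ (n + 1)`, which partition the natural numbers. -/
def block (n : ℕ) : Finset ℕ := Finset.Ico (blockStart n) (blockStart (n + 1))

/-- The number of the block to which an index belongs. -/
def blockIndex (j : ℕ) : ℕ := Nat.log 2 (j + 2) - 1

theorem blockStart_add_two (n : ℕ) : blockStart n + 2 = 2 ^ (n + 1) := by
  have : 2 ^ 1 ≤ 2 ^ (n + 1) := Nat.pow_le_pow_right (by norm_num) (by omega)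
  unfold blockStart
  omega

theorem blockStart_succ (n : ℕ) : blockStart (n + 1) = 2 * blockStart n + 2 := by
  have h1 := blockStart_add_two n
  have h2 := blockStart_add_two (n + 1)
  rw [pow_succ] at h2
  omega

theorem mem_block {j n : ℕ} : j ∈ block n ↔ blockIndex j = n := by
  have h1 := blockStart_add_two n
  have h2 := blockStart_add_two (n + 1)
  have h3 : 1 ≤ Nat.log 2 (j + 2) := Nat.le_log_of_pow_le (by norm_num) (by omega)
  have h4 : Nat.log 2 (j + 2) = n + 1 ↔ 2 ^ (n + 1) ≤ j + 2 ∧ j + 2 < 2 ^ (n + 1 + 1) :=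
    Nat.log_eq_iff (Or.inl (by omega))
  have h5 : blockIndex j = n ↔ Nat.log 2 (j + 2) = n + 1 := by
    unfold blockIndex
    omega
  rw [h5, h4, block, Finset.mem_Ico]
  omega

theorem mem_block_blockIndex (j : ℕ) : j ∈ block (blockIndex j) := mem_block.2 rfl

theorem blockStart_mem_block (n : ℕ) : blockStart n ∈ block n := by
  have := blockStart_succ n
  rw [block, Finset.mem_Ico]
  omega

/-- The index `j` is the first one of its block. -/
def IsBlockStart (j : ℕ) : Prop := j = blockStart (blockIndex j)

instance : DecidablePred IsBlockStart := fun j => inferInstanceAs (Decidable (j = _))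

theorem isBlockStart_iff {j n : ℕ} (hj : j ∈ block n) : IsBlockStart j ↔ j = blockStart n := by
  rw [IsBlockStart, mem_block.1 hj]

/-- In each block, the weights vanish at the first index, are constant otherwise, and add up
to one. -/
noncomputable def blockWeight (j : ℕ) : ℝ :=
  if IsBlockStart j then 0 else ((blockStart (blockIndex j) : ℝ) + 1)⁻¹

theorem blockWeight_nonneg (j : ℕ) : 0 ≤ blockWeight j := by
  unfold blockWeight
  split_ifs <;> positivity

theorem blockWeight_of_isBlockStart {j : ℕ} (h : IsBlockStart j) : blockWeight j = 0 := if_pos h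

/-- Block lengths are comparable with the indices in them; this is the source of the `O(1 / j)` in
`HarmonicBound`. -/
theorem add_one_mul_blockWeight_le (j : ℕ) : ((j : ℝ) + 1) * blockWeight j ≤ 2 := by
  unfold blockWeight
  split_ifs
  · simp
  · rw [← div_eq_mul_inv, div_le_iff₀ (by positivity)]
    have h1 := mem_block_blockIndex j
    rw [block, Finset.mem_Ico, blockStart_succ] at h1
    have h2 : (j : ℝ) + 1 ≤ 2 * blockStart (blockIndex j) + 2 := by exact_mod_cast h1.2
    linarith

theorem sum_blockWeight (n : ℕ) : ∑ j ∈ block n, blockWeight j = 1 := by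
  have h1 : ∑ j ∈ block n, blockWeight j
      = ∑ j ∈ (block n).erase (blockStart n), ((blockStart n : ℝ) + 1)⁻¹ := by
    rw [← Finset.add_sum_erase _ _ (blockStart_mem_block n), blockWeight_of_isBlockStart
      ((isBlockStart_iff (blockStart_mem_block n)).2 rfl), zero_add]
    refine Finset.sum_congr rfl fun j hj => ?_
    rw [Finset.mem_erase] at hj
    rw [blockWeight, if_neg (fun h => hj.1 ((isBlockStart_iff hj.2).1 h)), mem_block.1 hj.2]
  have h2 : ((block n).erase (blockStart n)).card = blockStart n + 1 := by
    rw [Finset.card_erase_of_mem (blockStart_mem_block n), block, Nat.card_Ico, blockStart_succ]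
    omega
  rw [h1, Finset.sum_const, h2, nsmul_eq_mul]
  push_cast
  field_simp

/-! ### The basis built from a block system -/

section

variable {𝕜 X : Type*} [RCLike 𝕜] [NormedAddCommGroup X] [NormedSpace 𝕜 X]

/-- Two mutually orthogonal biorthogonal systems that span a dense subspace: `(v, v')`, with bounded
partial sum operators, and `(e, e')`, equivalent to the unit vector basis of `ℓ₁` and indexed by the
natural numbers that do not start a block. -/
structure BlockSystem (v : ℕ → X) (v' : ℕ → StrongDual 𝕜 X) (e : ℕ → X)
    (e' : ℕ → StrongDual 𝕜 X) (C : ℝ) : Prop where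
  norm_v_le : ∀ n, ‖v n‖ ≤ C
  norm_v'_le : ∀ n f, ‖v' n f‖ ≤ C * ‖f‖
  norm_e_le : ∀ j, ‖e j‖ ≤ C
  sum_e'_le : ∀ (A : Finset ℕ) f, ∑ j ∈ A, ‖e' j f‖ ≤ C * ‖f‖
  v'_v : ∀ i j, v' i (v j) = if i = j then 1 else 0
  v'_e : ∀ i j, v' i (e j) = 0
  e'_v : ∀ i j, e' i (v j) = 0
  e'_e : ∀ i j, ¬ IsBlockStart i → e' i (e j) = if i = j then 1 else 0
  e_start : ∀ j, IsBlockStart j → e j = 0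
  e'_start : ∀ j, IsBlockStart j → e' j = 0
  norm_sum_le : ∀ n f, ‖∑ k ∈ Finset.range n, v' k f • v k‖ ≤ C * ‖f‖
  dense : ∀ f, f ∈ (Submodule.span 𝕜 (Set.range v ∪ Set.range e)).topologicalClosure

namespace BlockSystem

/-- The weighted average of the vectors of a block. -/
noncomputable def avg (e : ℕ → X) (n : ℕ) : X :=
  ∑ j ∈ block n, (blockWeight j : 𝕜) • e j

/-- The vectors of the basis built from a block system. -/
noncomputable def vec (𝕜 : Type*) [RCLike 𝕜] {X : Type*} [NormedAddCommGroup X] [NormedSpace 𝕜 X]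
    (v e : ℕ → X) (j : ℕ) : X :=
  v (blockIndex j) + e j - avg (𝕜 := 𝕜) e (blockIndex j)

/-- The coordinate functionals of the basis built from a block system. -/
noncomputable def functional (v' e' : ℕ → StrongDual 𝕜 X) (j : ℕ) : StrongDual 𝕜 X :=
  e' j + (blockWeight j : 𝕜) • v' (blockIndex j)
    - if IsBlockStart j then ∑ i ∈ block (blockIndex j), e' i else 0

variable {v : ℕ → X} {v' : ℕ → StrongDual 𝕜 X} {e : ℕ → X} {e' : ℕ → StrongDual 𝕜 X} {C : ℝ}

theorem vec_eq {j n : ℕ} (hj : j ∈ block n) : vec 𝕜 v e j = (v n - avg (𝕜 := 𝕜) e n) + e j := by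
  rw [vec, mem_block.1 hj]
  abel

theorem sum_coe_blockWeight (n : ℕ) : ∑ j ∈ block n, (blockWeight j : 𝕜) = 1 := by
  rw [← RCLike.ofReal_sum, sum_blockWeight, RCLike.ofReal_one]

theorem norm_coe_blockWeight (j : ℕ) : ‖(blockWeight j : 𝕜)‖ = blockWeight j :=
  RCLike.norm_of_nonneg (blockWeight_nonneg j)

theorem sum_blockWeight_smul_vec (n : ℕ) :
    ∑ j ∈ block n, (blockWeight j : 𝕜) • vec 𝕜 v e j = v n := by
  rw [Finset.sum_congr rfl fun j hj => by rw [vec_eq (𝕜 := 𝕜) hj, smul_add],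
    Finset.sum_add_distrib, ← Finset.sum_smul, sum_coe_blockWeight, one_smul]
  simp [avg]

variable (h : BlockSystem v v' e e' C)
include h

theorem nonneg : 0 ≤ C := (norm_nonneg _).trans (h.norm_v_le 0)

theorem norm_vec_le (j : ℕ) : ‖vec 𝕜 v e j‖ ≤ 3 * C := by
  have hu : ‖avg (𝕜 := 𝕜) e (blockIndex j)‖ ≤ C := by
    calc _ ≤ ∑ i ∈ block (blockIndex j), blockWeight i * C := by
          refine norm_sum_le_of_le _ fun i _ => ?_
          rw [norm_smul, norm_coe_blockWeight]
          exact mul_le_mul_of_nonneg_left (h.norm_e_le i) (blockWeight_nonneg i)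
      _ = C := by rw [← Finset.sum_mul, sum_blockWeight, one_mul]
  calc _ ≤ ‖v (blockIndex j)‖ + ‖e j‖ + ‖avg (𝕜 := 𝕜) e (blockIndex j)‖ :=
        (norm_sub_le _ _).trans (by gcongr; exact norm_add_le _ _)
    _ ≤ C + C + C := by gcongr; exacts [h.norm_v_le _, h.norm_e_le _]
    _ = 3 * C := by ring

/-- The correction at the block start cancels the total of the `e'`, so the coefficients of the
block add up to `v' n f`. This is the factor of the common part `v n - avg`, and the two multiples
of `avg` cancel. -/
theorem sum_functional_smul_vec (n : ℕ) (f : X) :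
    ∑ j ∈ block n, functional v' e' j f • vec 𝕜 v e j
      = v' n f • v n + ∑ j ∈ block n, e' j f • e j := by
  have hs := blockStart_mem_block n
  have happ : ∀ j ∈ block n, functional v' e' j f = e' j f + blockWeight j * v' n f
      - if j = blockStart n then ∑ i ∈ block n, e' i f else 0 := by
    intro j hj
    simp only [functional, mem_block.1 hj, isBlockStart_iff hj]
    split_ifs <;> simp [_root_.sum_apply]
  have hsum : ∑ j ∈ block n, functional v' e' j f = v' n f := by
    rw [Finset.sum_congr rfl happ, Finset.sum_sub_distrib, Finset.sum_add_distrib,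
      ← Finset.sum_mul, sum_coe_blockWeight, Finset.sum_ite_eq', if_pos hs]
    ring
  have he : e (blockStart n) = 0 := h.e_start _ ((isBlockStart_iff hs).2 rfl)
  have hsum2 : ∑ j ∈ block n, functional v' e' j f • e j
      = ∑ j ∈ block n, e' j f • e j + v' n f • avg (𝕜 := 𝕜) e n := by
    rw [avg, Finset.smul_sum, ← Finset.sum_add_distrib]
    refine Finset.sum_congr rfl fun j hj => ?_
    rw [happ j hj]
    split_ifs with hj'
    · simp [hj', he]
    · rw [sub_zero, add_smul, mul_comm, mul_smul]
  rw [Finset.sum_congr rfl fun j hj => by rw [vec_eq (𝕜 := 𝕜) hj, smul_add],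
    Finset.sum_add_distrib, ← Finset.sum_smul, hsum, hsum2, smul_sub]
  abel

theorem functional_vec (i j : ℕ) :
    functional v' e' i (vec 𝕜 v e j) = if i = j then 1 else 0 := by
  have he' : ∀ i, e' i (vec 𝕜 v e j) = (if i = j ∧ ¬ IsBlockStart j then 1 else 0)
      - if blockIndex i = blockIndex j then (blockWeight i : 𝕜) else 0 := by
    intro i
    by_cases hi : IsBlockStart i
    · rw [h.e'_start i hi, blockWeight_of_isBlockStart hi]
      have : ¬ (i = j ∧ ¬ IsBlockStart j) := fun h => h.2 (h.1 ▸ hi)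
      simp [this]
    · have h1 : (i = j ∧ ¬ IsBlockStart j) ↔ i = j := ⟨fun h => h.1, fun h => ⟨h, h ▸ hi⟩⟩
      simp only [vec, avg, map_sub, map_add, map_sum, map_smul, h.e'_v, h.e'_e i _ hi, h1,
        smul_eq_mul, mul_ite, mul_one, mul_zero, Finset.sum_ite_eq, mem_block, zero_add]
  have hv' : ∀ n, v' n (vec 𝕜 v e j) = if n = blockIndex j then 1 else 0 := by
    intro n
    simp only [vec, avg, map_sub, map_add, map_sum, map_smul, h.v'_v, h.v'_e, smul_zero,
      Finset.sum_const_zero, add_zero, sub_zero]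
  by_cases hi : IsBlockStart i
  -- For `j` in the block of `i`, the total is `1 - 1 = 0` unless `j` is the block start, where it
  -- is `-1`.
  · have hsum : ∑ k ∈ block (blockIndex i), e' k (vec 𝕜 v e j)
        = (if blockIndex i = blockIndex j ∧ ¬ IsBlockStart j then 1 else 0)
          - if blockIndex i = blockIndex j then 1 else 0 := by
      simp only [he', Finset.sum_sub_distrib]
      congr 1
      · by_cases hj : IsBlockStart j
        · simp [hj]
        · simp [hj, mem_block, eq_comm]
      · rw [← sum_coe_blockWeight (𝕜 := 𝕜) (blockIndex i), Finset.sum_congr rfl fun k hk => by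
          rw [mem_block.1 hk]]
        split_ifs <;> simp
    have h2 : functional v' e' i (vec 𝕜 v e j)
        = - ∑ k ∈ block (blockIndex i), e' k (vec 𝕜 v e j) := by
      simp [functional, hi, blockWeight_of_isBlockStart hi, h.e'_start i hi, _root_.sum_apply]
    have h3 : i = j ↔ blockIndex i = blockIndex j ∧ IsBlockStart j := by
      constructor
      · rintro rfl
        exact ⟨rfl, hi⟩
      · rintro ⟨h1, h2⟩
        rw [hi, h2, h1]
    rw [h2, hsum]
    simp only [h3]
    by_cases h4 : blockIndex i = blockIndex j <;> by_cases h5 : IsBlockStart j <;> simp [h4, h5]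
  · have h2 : functional v' e' i (vec 𝕜 v e j)
        = e' i (vec 𝕜 v e j) + blockWeight i * v' (blockIndex i) (vec 𝕜 v e j) := by
      simp [functional, hi]
    have h1 : (i = j ∧ ¬ IsBlockStart j) ↔ i = j := ⟨fun h => h.1, fun h => ⟨h, h ▸ hi⟩⟩
    rw [h2, he', hv']
    simp only [h1]
    split_ifs <;> simp

/-- Blocks are disjoint, so each `e' i f` enters at most twice: on its own and in the correction at
its block start. -/
theorem sum_norm_functional_sub_le (A : Finset ℕ) (f : X) :
    ∑ j ∈ A, ‖functional v' e' j f - (blockWeight j : 𝕜) * v' (blockIndex j) f‖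
      ≤ 2 * C * ‖f‖ := by
  have h1 : ∀ j, ‖functional v' e' j f - (blockWeight j : 𝕜) * v' (blockIndex j) f‖
      ≤ ‖e' j f‖ + if IsBlockStart j then ∑ i ∈ block (blockIndex j), ‖e' i f‖ else 0 := by
    intro j
    by_cases hj : IsBlockStart j
    · have : functional v' e' j f - (blockWeight j : 𝕜) * v' (blockIndex j) f
          = e' j f - ∑ i ∈ block (blockIndex j), e' i f := by
        simp only [functional, if_pos hj, _root_.sub_apply, _root_.add_apply, _root_.sum_apply,
          _root_.smul_apply, smul_eq_mul]
        ring
      rw [this, if_pos hj]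
      exact (norm_sub_le _ _).trans (by gcongr; exact _root_.norm_sum_le _ _)
    · simp [functional, hj]
  have h2 : ∑ j ∈ A, (if IsBlockStart j then ∑ i ∈ block (blockIndex j), ‖e' i f‖ else 0)
      ≤ C * ‖f‖ := by
    rw [← Finset.sum_filter, ← Finset.sum_biUnion]
    · exact h.sum_e'_le _ f
    · intro j hj k hk hjk
      simp only [Finset.coe_filter, Set.mem_ofPred_eq] at hj hk
      refine Finset.disjoint_left.2 fun i hij hik => hjk ?_
      rw [mem_block] at hij hik
      rw [hj.2, hk.2, ← hij, ← hik]
  calc _ ≤ ∑ j ∈ A, (‖e' j f‖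
        + if IsBlockStart j then ∑ i ∈ block (blockIndex j), ‖e' i f‖ else 0) :=
        Finset.sum_le_sum fun j _ => h1 j
    _ ≤ C * ‖f‖ + C * ‖f‖ := by
      rw [Finset.sum_add_distrib]
      exact add_le_add (h.sum_e'_le A f) h2
    _ = _ := by ring

theorem sum_block_norm_functional_le (n : ℕ) (f : X) :
    ∑ j ∈ block n, ‖functional v' e' j f‖ ≤ 3 * C * ‖f‖ := by
  calc ∑ j ∈ block n, ‖functional v' e' j f‖
      ≤ ∑ j ∈ block n, (‖functional v' e' j f - (blockWeight j : 𝕜) * v' (blockIndex j) f‖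
        + blockWeight j * (C * ‖f‖)) := by
        refine Finset.sum_le_sum fun j _ => ?_
        have h1 := norm_sub_norm_le (functional v' e' j f)
          ((blockWeight j : 𝕜) * v' (blockIndex j) f)
        rw [norm_mul, norm_coe_blockWeight] at h1
        have h2 := mul_le_mul_of_nonneg_left (h.norm_v'_le (blockIndex j) f) (blockWeight_nonneg j)
        linarith
    _ ≤ 2 * C * ‖f‖ + 1 * (C * ‖f‖) := by
      rw [Finset.sum_add_distrib, ← Finset.sum_mul, sum_blockWeight]
      gcongr
      exact h.sum_norm_functional_sub_le _ f
    _ = _ := by ring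

theorem sum_range_blockStart (n : ℕ) (f : X) :
    ∑ j ∈ Finset.range (blockStart n), functional v' e' j f • vec 𝕜 v e j
      = ∑ k ∈ Finset.range n, v' k f • v k + ∑ j ∈ Finset.range (blockStart n), e' j f • e j := by
  induction n with
  | zero => simp [blockStart]
  | succ n ih =>
    have hle : blockStart n ≤ blockStart (n + 1) := by
      rw [blockStart_succ]
      omega
    rw [← Finset.sum_range_add_sum_Ico _ hle,
      ← Finset.sum_range_add_sum_Ico (fun j => e' j f • e j) hle, ih, Finset.sum_range_succ]
    have := h.sum_functional_smul_vec n f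
    rw [block] at this
    rw [this]
    abel

/-- Complete blocks give a partial sum of the original system. The incomplete last block is bounded
absolutely, since its coefficients have `ℓ₁` norm at most `3 * C * ‖f‖`. -/
theorem norm_sum_functional_smul_vec_le (m : ℕ) (f : X) :
    ‖∑ j ∈ Finset.range m, functional v' e' j f • vec 𝕜 v e j‖ ≤ (C + 10 * C ^ 2) * ‖f‖ := by
  have hC := h.nonneg
  have hm := mem_block_blockIndex m
  set n := blockIndex m
  have hm' := hm
  rw [block, Finset.mem_Ico] at hm'
  rw [← Finset.sum_range_add_sum_Ico _ hm'.1, h.sum_range_blockStart]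
  have h1 : ‖∑ j ∈ Finset.range (blockStart n), e' j f • e j‖ ≤ (C * ‖f‖) * C := by
    calc _ ≤ ∑ j ∈ Finset.range (blockStart n), ‖e' j f‖ * C := by
          refine norm_sum_le_of_le _ fun j _ => ?_
          rw [norm_smul]
          gcongr
          exact h.norm_e_le j
      _ ≤ _ := by
        rw [← Finset.sum_mul]
        gcongr
        exact h.sum_e'_le _ f
  have h2 : ‖∑ j ∈ Finset.Ico (blockStart n) m, functional v' e' j f • vec 𝕜 v e j‖
      ≤ (3 * C * ‖f‖) * (3 * C) := by
    calc _ ≤ ∑ j ∈ Finset.Ico (blockStart n) m, ‖functional v' e' j f‖ * (3 * C) := by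
          refine norm_sum_le_of_le _ fun j _ => ?_
          rw [norm_smul]
          gcongr
          exact h.norm_vec_le j
      _ ≤ ∑ j ∈ block n, ‖functional v' e' j f‖ * (3 * C) :=
          Finset.sum_le_sum_of_subset_of_nonneg (Finset.Ico_subset_Ico_right hm'.2.le)
            fun _ _ _ => by positivity
      _ ≤ _ := by
        rw [← Finset.sum_mul]
        gcongr
        exact h.sum_block_norm_functional_le n f
  calc _ ≤ C * ‖f‖ + (C * ‖f‖) * C + (3 * C * ‖f‖) * (3 * C) :=
        (norm_add_le _ _).trans (add_le_add ((norm_add_le _ _).trans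
          (add_le_add (h.norm_sum_le n f) h1)) h2)
    _ = _ := by ring

theorem mem_closure_span_vec (f : X) :
    f ∈ (Submodule.span 𝕜 (Set.range (vec 𝕜 v e))).topologicalClosure := by
  refine Submodule.topologicalClosure_mono (Submodule.span_le.2 ?_) (h.dense f)
  have hx : ∀ j, vec 𝕜 v e j ∈ Submodule.span 𝕜 (Set.range (vec 𝕜 v e)) :=
    fun j => Submodule.subset_span ⟨j, rfl⟩
  rintro _ (⟨n, rfl⟩ | ⟨j, rfl⟩)
  · rw [← sum_blockWeight_smul_vec (𝕜 := 𝕜) (v := v) (e := e) n]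
    exact Submodule.sum_mem _ fun j _ => Submodule.smul_mem _ _ (hx j)
  · have hs := blockStart_mem_block (blockIndex j)
    have : e j = vec 𝕜 v e j - vec 𝕜 v e (blockStart (blockIndex j)) := by
      rw [vec_eq (𝕜 := 𝕜) (mem_block_blockIndex j), vec_eq (𝕜 := 𝕜) hs,
        h.e_start _ ((isBlockStart_iff hs).2 rfl)]
      abel
    rw [this]
    exact Submodule.sub_mem _ (hx _) (hx _)

theorem exists_basis : ∃ b : SchauderBasis 𝕜 X, b.HarmonicBound (3 * C) ∧
    ∀ n, ∑ j ∈ block n, (blockWeight j : 𝕜) • b j = v n := by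
  obtain ⟨b, hb, hb'⟩ := exists_of_biorthogonal (vec 𝕜 v e) (functional v' e') h.functional_vec _
    h.norm_sum_functional_smul_vec_le h.mem_closure_span_vec
  have hC := h.nonneg
  refine ⟨b, ⟨fun j => ?_, fun f => ⟨fun j => (blockWeight j : 𝕜) * v' (blockIndex j) f,
    fun j => ?_, fun A => ?_⟩⟩, fun n => ?_⟩
  · rw [hb]
    exact h.norm_vec_le j
  · rw [norm_mul, norm_coe_blockWeight, ← mul_assoc]
    calc _ ≤ 2 * (C * ‖f‖) := mul_le_mul (add_one_mul_blockWeight_le j) (h.norm_v'_le _ f)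
          (norm_nonneg _) zero_le_two
      _ ≤ 3 * C * ‖f‖ := by
        have : 0 ≤ C * ‖f‖ := by positivity
        linarith
  · rw [hb']
    refine (h.sum_norm_functional_sub_le A f).trans ?_
    gcongr
    norm_num
  · rw [hb]
    exact sum_blockWeight_smul_vec n

end BlockSystem

/-- Projecting onto the union of the blocks in `B` sends `∑ n ∈ A, v n` to `∑ n ∈ B, v n`, so
conditionality of `v` passes to `b` on an exponential scale of indices. -/
theorem le_condConst_of_sum_block (b : SchauderBasis 𝕜 X) {v : ℕ → X}
    (hv : ∀ n, ∑ j ∈ block n, (blockWeight j : 𝕜) • b j = v n) {c D : ℝ} (hc : 0 < c)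
    {K : ℕ} {A B : Finset ℕ} (hA : A ⊆ Finset.range K) (hBA : B ⊆ A)
    (hD : ‖∑ n ∈ A, v n‖ ≤ D) (hB : c ≤ ‖∑ n ∈ B, v n‖) :
    ENNReal.ofReal (c / D) ≤ b.condConst (2 ^ (K + 1)) := by
  have hcoord : ∀ j n, b.coord j (v n) = if blockIndex j = n then (blockWeight j : 𝕜) else 0 := by
    intro j n
    simp only [← hv, map_sum, map_smul, coord_basis, smul_eq_mul, mul_ite, mul_one, mul_zero,
      Finset.sum_ite_eq, mem_block]
  have hcoordA : ∀ j, b.coord j (∑ n ∈ A, v n)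
      = if blockIndex j ∈ A then (blockWeight j : 𝕜) else 0 := by
    intro j
    simp only [map_sum, hcoord, Finset.sum_ite_eq]
  have hproj : GeneralSchauderBasis.proj b (B.biUnion block) (∑ n ∈ A, v n) = ∑ n ∈ B, v n := by
    rw [GeneralSchauderBasis.proj_apply, Finset.sum_biUnion]
    · refine Finset.sum_congr rfl fun n hn => ?_
      rw [← hv]
      refine Finset.sum_congr rfl fun j hj => ?_
      rw [hcoordA, mem_block.1 hj, if_pos (hBA hn)]
    · intro m _ n _ hmn
      refine Finset.disjoint_left.2 fun i hi hi' => hmn ?_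
      rw [← mem_block.1 hi, ← mem_block.1 hi']
  have hne : ∑ n ∈ A, v n ≠ 0 := by
    intro h0
    rw [h0, map_zero] at hproj
    rw [← hproj, norm_zero] at hB
    linarith
  have hsupp : ∀ j, b.coord j (∑ n ∈ A, v n) ≠ 0 → j < 2 ^ (K + 1) := by
    intro j hj
    rw [hcoordA] at hj
    have hjA : blockIndex j ∈ A := by
      by_contra h0
      simp [h0] at hj
    have h1 := Finset.mem_range.1 (hA hjA)
    have h2 := (Finset.mem_Ico.1 (mem_block_blockIndex j)).2
    have h3 := blockStart_add_two (blockIndex j + 1)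
    have h4 : 2 ^ (blockIndex j + 1 + 1) ≤ 2 ^ (K + 1) :=
      Nat.pow_le_pow_right (by norm_num) (by omega)
    omega
  refine le_iSup₂_of_le _ hne (le_iSup₂_of_le hsupp (B.biUnion block) ?_)
  have hpos : 0 < ‖∑ n ∈ A, v n‖ := norm_pos_iff.2 hne
  rw [hproj, ← ofReal_norm, ← ofReal_norm, ← ENNReal.ofReal_div_of_pos hpos]
  exact ENNReal.ofReal_le_ofReal (div_le_div₀ (norm_nonneg _) hB hpos hD)

end

end SchauderBasis

/-! ### The space `ℓ₁` and its complemented copies -/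

namespace EllOne

open Filter Topology

variable (𝕜 : Type*) [RCLike 𝕜]

/-- The Banach space `ℓ₁`. -/
abbrev Space := lp (fun _ : ℕ => 𝕜) 1

/-- The unit vectors of `ℓ₁`. -/
noncomputable def unitVec (i : ℕ) : Space 𝕜 := lp.single 1 i (1 : 𝕜)

/-- The coordinate functionals of `ℓ₁`. -/
noncomputable def eval (i : ℕ) : StrongDual 𝕜 (Space 𝕜) := lp.evalCLM 𝕜 (fun _ : ℕ => 𝕜) 1 i

variable {𝕜}

theorem eval_apply (i : ℕ) (y : Space 𝕜) : eval 𝕜 i y = y i := rfl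

theorem eval_unitVec (i j : ℕ) : eval 𝕜 i (unitVec 𝕜 j) = if i = j then 1 else 0 := by
  rw [eval_apply, unitVec, lp.single_apply]
  split_ifs with h
  · subst h; simp
  · simp [h]

theorem norm_unitVec (i : ℕ) : ‖unitVec 𝕜 i‖ = 1 := by
  rw [unitVec, lp.norm_single one_pos, norm_one]

theorem hasSum_norm (y : Space 𝕜) : HasSum (fun i => ‖y i‖) ‖y‖ := by
  simpa using lp.hasSum_norm (p := 1) (by simp) y

theorem sum_norm_le (A : Finset ℕ) (y : Space 𝕜) : ∑ i ∈ A, ‖y i‖ ≤ ‖y‖ :=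
  sum_le_hasSum A (fun _ _ => norm_nonneg _) (hasSum_norm y)

theorem hasSum_unitVec (y : Space 𝕜) : HasSum (fun i => y i • unitVec 𝕜 i) y := by
  have h := lp.hasSum_single (p := 1) ENNReal.one_ne_top y
  have : (fun i => y i • unitVec 𝕜 i) = fun i => lp.single 1 i (y i) := by
    funext i
    rw [unitVec, ← lp.single_smul, smul_eq_mul, mul_one]
  rwa [this]

variable {Z : Type*} [NormedAddCommGroup Z] [NormedSpace 𝕜 Z]

theorem clm_ext {S T : Space 𝕜 →L[𝕜] Z} (h : ∀ i, S (unitVec 𝕜 i) = T (unitVec 𝕜 i)) : S = T := by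
  ext y
  have h1 := (hasSum_unitVec y).mapL S
  have h2 := (hasSum_unitVec y).mapL T
  simp only [map_smul, h] at h1 h2
  exact h1.unique h2

/-- A bounded sequence in a Banach space is the image of the unit vector basis of `ℓ₁` under a
bounded operator. -/
theorem exists_lift [CompleteSpace Z] {z : ℕ → Z} {C : ℝ} (hz : ∀ i, ‖z i‖ ≤ C) :
    ∃ T : Space 𝕜 →L[𝕜] Z, (∀ i, T (unitVec 𝕜 i) = z i) ∧ ∀ y, ‖T y‖ ≤ C * ‖y‖ := by
  have hle : ∀ (y : Space 𝕜) i, ‖y i • z i‖ ≤ C * ‖y i‖ := fun y i => by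
    rw [norm_smul, mul_comm]
    gcongr
    exact hz i
  have hs : ∀ y : Space 𝕜, Summable fun i => y i • z i := fun y =>
    .of_norm_bounded ((hasSum_norm y).summable.mul_left C) (hle y)
  have hb : ∀ y : Space 𝕜, ‖∑' i, y i • z i‖ ≤ C * ‖y‖ := fun y =>
    tsum_of_norm_bounded ((hasSum_norm y).mul_left C) (hle y)
  let T : Space 𝕜 →ₗ[𝕜] Z :=
    { toFun := fun y => ∑' i, y i • z i
      map_add' := fun x y => by
        rw [← (hs x).tsum_add (hs y)]
        exact tsum_congr fun i => by rw [lp.coeFn_add, Pi.add_apply, add_smul]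
      map_smul' := fun c y => by
        rw [RingHom.id_apply, ← (hs y).tsum_const_smul]
        exact tsum_congr fun i => by rw [lp.coeFn_smul, Pi.smul_apply, smul_eq_mul, mul_smul] }
  refine ⟨T.mkContinuous C hb, fun i => ?_, hb⟩
  change ∑' j, unitVec 𝕜 i j • z j = z i
  rw [tsum_eq_single i fun j hj => by
    rw [← eval_apply, eval_unitVec, if_neg hj, zero_smul], ← eval_apply, eval_unitVec, if_pos rfl,
    one_smul]

/-- Coordinates are sorted by parity; by `clm_ext` the inverse relations need checking only on unit
vectors. -/
theorem nonempty_equiv_prod : Nonempty (Space 𝕜 ≃L[𝕜] Space 𝕜 × Space 𝕜) := by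
  obtain ⟨F, hF, -⟩ := exists_lift (𝕜 := 𝕜) (C := 1)
    (z := fun i => if Even i then (unitVec 𝕜 (i / 2), (0 : Space 𝕜))
      else ((0 : Space 𝕜), unitVec 𝕜 (i / 2)))
    (fun i => by split_ifs <;> simp [Prod.norm_def, norm_unitVec])
  obtain ⟨G₁, hG₁, -⟩ := exists_lift (𝕜 := 𝕜) (C := 1) (z := fun i => unitVec 𝕜 (2 * i))
    (fun i => (norm_unitVec _).le)
  obtain ⟨G₂, hG₂, -⟩ := exists_lift (𝕜 := 𝕜) (C := 1) (z := fun i => unitVec 𝕜 (2 * i + 1))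
    (fun i => (norm_unitVec _).le)
  have h1 : (G₁.coprod G₂).comp F = ContinuousLinearMap.id 𝕜 _ := by
    refine clm_ext fun i => ?_
    rw [ContinuousLinearMap.comp_apply, hF]
    split_ifs with hi
    · simp [hG₁, Nat.two_mul_div_two_of_even hi]
    · rw [Nat.not_even_iff_odd] at hi
      simp [hG₂, Nat.two_mul_div_two_add_one_of_odd hi]
  have h2 : F.comp G₁ = ContinuousLinearMap.inl 𝕜 _ _ := by
    refine clm_ext fun i => ?_
    rw [ContinuousLinearMap.comp_apply, hG₁, hF, if_pos (even_two_mul i)]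
    simp
  have h3 : F.comp G₂ = ContinuousLinearMap.inr 𝕜 _ _ := by
    refine clm_ext fun i => ?_
    rw [ContinuousLinearMap.comp_apply, hG₂, hF, if_neg (by simp)]
    have : (2 * i + 1) / 2 = i := by omega
    simp [this]
  refine ⟨ContinuousLinearEquiv.equivOfInverse F (G₁.coprod G₂)
    (fun y => congrArg (fun T => T y) h1) fun p => ?_⟩
  have h4 := congrArg (fun T => T p.1) h2
  have h5 := congrArg (fun T => T p.2) h3
  simp only [ContinuousLinearMap.comp_apply, ContinuousLinearMap.inl_apply,
    ContinuousLinearMap.inr_apply] at h4 h5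
  rw [ContinuousLinearMap.coprod_apply, map_add, h4, h5]
  simp

/-- A space with a complemented copy of `ℓ₁` is isomorphic to its direct sum with `ℓ₁`. -/
theorem nonempty_equiv_prod_of_complemented (h : IsomorphicToComplemented 𝕜 (Space 𝕜) Z) :
    Nonempty (Z ≃L[𝕜] Z × Space 𝕜) := by
  obtain ⟨p, ⟨P, hP⟩, ⟨φ⟩⟩ := h
  obtain ⟨θ⟩ := nonempty_equiv_prod (𝕜 := 𝕜)
  let R : Z →L[𝕜] Space 𝕜 := (φ.symm : p →L[𝕜] Space 𝕜).comp P
  let J : Space 𝕜 →L[𝕜] Z := p.subtypeL.comp (φ : Space 𝕜 →L[𝕜] p)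
  have hRJ : ∀ y, R (J y) = y := fun y => by
    change φ.symm (P (φ y)) = y
    rw [hP, φ.symm_apply_apply]
  -- Here `Z` is the sum of `ker R` and the copy `J` of `ℓ₁`. The map `F` fixes `ker R` and splits
  -- `R x` by `θ`: one half goes back into the copy, the other to the new factor. `G` reverses this.
  let F : Z →L[𝕜] Z × Space 𝕜 := ContinuousLinearMap.prod
    (ContinuousLinearMap.id 𝕜 Z - J.comp R + J.comp ((ContinuousLinearMap.fst 𝕜 _ _).comp
      ((θ : Space 𝕜 →L[𝕜] Space 𝕜 × Space 𝕜).comp R)))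
    ((ContinuousLinearMap.snd 𝕜 _ _).comp ((θ : Space 𝕜 →L[𝕜] Space 𝕜 × Space 𝕜).comp R))
  let G : Z × Space 𝕜 →L[𝕜] Z :=
    (ContinuousLinearMap.id 𝕜 Z - J.comp R).comp (ContinuousLinearMap.fst 𝕜 _ _)
      + J.comp ((θ.symm : Space 𝕜 × Space 𝕜 →L[𝕜] Space 𝕜).comp
        (R.prodMap (ContinuousLinearMap.id 𝕜 _)))
  have hF : ∀ x, F x = (x - J (R x) + J (θ (R x)).1, (θ (R x)).2) := fun _ => rfl
  have hG : ∀ x y, G (x, y) = x - J (R x) + J (θ.symm (R x, y)) := fun _ _ => rfl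
  refine ⟨ContinuousLinearEquiv.equivOfInverse F G (fun x => ?_) fun q => ?_⟩
  · rw [hF, hG]
    simp only [map_add, map_sub, hRJ, sub_self, zero_add, Prod.mk.eta, θ.symm_apply_apply]
    abel
  · obtain ⟨x, y⟩ := q
    rw [hG, hF]
    simp only [map_add, map_sub, hRJ, sub_self, zero_add, θ.apply_symm_apply]
    congr 1
    abel

/-! ### The conditional difference basis of `ℓ₁` -/

/-- The vectors `e_k - e_{k-1}`. -/
noncomputable def diffVec (𝕜 : Type*) [RCLike 𝕜] (k : ℕ) : Space 𝕜 :=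
  unitVec 𝕜 k - if k = 0 then 0 else unitVec 𝕜 (k - 1)

theorem sum_range_diffVec (k : ℕ) :
    ∑ i ∈ Finset.range (k + 1), diffVec 𝕜 i = unitVec 𝕜 k := by
  induction k with
  | zero => simp [diffVec]
  | succ k ih =>
    rw [Finset.sum_range_succ, ih]
    simp [diffVec]

theorem norm_diffVec_le (k : ℕ) : ‖diffVec 𝕜 k‖ ≤ 2 := by
  refine (norm_sub_le _ _).trans ?_
  rw [norm_unitVec]
  split_ifs
  · simp
  · rw [norm_unitVec]
    norm_num

theorem one_le_norm_diffVec (k : ℕ) : 1 ≤ ‖diffVec 𝕜 k‖ := by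
  have h1 := sum_norm_le {k} (diffVec 𝕜 k)
  have h2 : eval 𝕜 k (diffVec 𝕜 k) = 1 := by
    rw [diffVec, map_sub, eval_unitVec, if_pos rfl]
    rcases k with _ | k
    · simp
    · simp [eval_unitVec]
  rw [Finset.sum_singleton, ← eval_apply, h2, norm_one] at h1
  exact h1

/-- Nothing telescopes here: the sum of the even coordinates is a functional of norm at most one
with value `1` at each summand. -/
theorem le_norm_sum_diffVec (k : ℕ) : (k : ℝ) ≤ ‖∑ i ∈ Finset.range k, diffVec 𝕜 (2 * i)‖ := by
  obtain ⟨T, hT, hT'⟩ := exists_lift (𝕜 := 𝕜) (C := 1) (z := fun i => if Even i then (1 : 𝕜) else 0)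
    (fun i => by split_ifs <;> simp)
  have h1 : ∀ i, T (diffVec 𝕜 (2 * i)) = 1 := by
    intro i
    rw [diffVec, map_sub, hT, if_pos (even_two_mul i)]
    rcases i with _ | i
    · simp
    · have : ¬ Even (2 * (i + 1) - 1) := by
        rw [Nat.not_even_iff_odd]
        exact ⟨i, by omega⟩
      simp [hT, this]
  have h2 := hT' (∑ i ∈ Finset.range k, diffVec 𝕜 (2 * i))
  simpa [h1] using h2

/-- The vectors `e_k - e_{k-1}` form a basis of `ℓ₁`. -/
theorem exists_diffBasis : ∃ d : SchauderBasis 𝕜 (Space 𝕜), d.basis = diffVec 𝕜 := by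
  -- The coordinate functionals are the tail sums `T k y = ∑_{i ≥ k} y i`.
  choose T hT hT' using fun k : ℕ => exists_lift (𝕜 := 𝕜) (C := 1)
    (z := fun i => if k ≤ i then (1 : 𝕜) else 0) (fun i => by split_ifs <;> simp)
  have hsucc : ∀ k y, T k y = y k + T (k + 1) y := by
    intro k y
    have : T k = eval 𝕜 k + T (k + 1) := clm_ext fun i => by
      rw [_root_.add_apply, hT, hT, eval_unitVec]
      rcases lt_trichotomy k i with h | h | h
      · simp [h.le, h.ne, Nat.succ_le_of_lt h]
      · simp [h]
      · simp [h.ne', not_le.2 h, not_le.2 (h.trans (Nat.lt_succ_self k))]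
    rw [this, _root_.add_apply, eval_apply]
  -- Summation by parts; each of the two terms has norm at most `‖y‖`.
  have hsum : ∀ m y, ∑ k ∈ Finset.range m, T k y • diffVec 𝕜 k
      = ∑ k ∈ Finset.range m, y k • unitVec 𝕜 k
        + T m y • if m = 0 then 0 else unitVec 𝕜 (m - 1) := by
    intro m y
    induction m with
    | zero => simp
    | succ m ih =>
      rw [Finset.sum_range_succ, ih, Finset.sum_range_succ, diffVec, smul_sub, hsucc m]
      simp only [add_smul, Nat.add_eq_zero_iff, one_ne_zero, and_false, if_false, Nat.add_sub_cancel]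
      abel
  refine (SchauderBasis.exists_of_biorthogonal (diffVec 𝕜) T (fun i j => ?_) 2
    (fun m y => ?_) fun y => ?_).imp fun d hd => hd.1
  · rw [diffVec, map_sub, hT]
    rcases j with _ | j
    · simp
    · simp only [Nat.add_eq_zero_iff, one_ne_zero, and_false, if_false, Nat.add_sub_cancel, hT]
      rcases lt_trichotomy i (j + 1) with h | h | h
      · simp [h.le, h.ne, Nat.le_of_lt_succ h]
      · simp [h]
      · simp [h.ne', not_le.2 h, not_le.2 ((Nat.lt_succ_self j).trans h)]
  · rw [hsum]
    have h1 : ‖∑ k ∈ Finset.range m, y k • unitVec 𝕜 k‖ ≤ ‖y‖ :=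
      (norm_sum_le_of_le _ fun k _ => by rw [norm_smul, norm_unitVec, mul_one]).trans
        (sum_norm_le _ y)
    have h2 : ‖T m y • if m = 0 then 0 else unitVec 𝕜 (m - 1)‖ ≤ ‖y‖ := by
      rw [norm_smul]
      have := hT' m y
      split_ifs
      · simp
      · rwa [norm_unitVec, mul_one, ← one_mul ‖y‖]
    linarith [norm_add_le (∑ k ∈ Finset.range m, y k • unitVec 𝕜 k)
      (T m y • if m = 0 then 0 else unitVec 𝕜 (m - 1))]
  · rw [← SetLike.mem_coe, Submodule.topologicalClosure_coe]
    refine mem_closure_of_tendsto (hasSum_unitVec y) (Eventually.of_forall fun A => ?_)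
    refine Submodule.sum_mem _ fun i _ => Submodule.smul_mem _ _ ?_
    rw [← sum_range_diffVec]
    exact Submodule.sum_mem _ fun j _ => Submodule.subset_span ⟨j, rfl⟩

end EllOne

/-! ### Normalization, direct sums and block systems -/

namespace SchauderBasis

variable {𝕜 X Y : Type*} [RCLike 𝕜] [NormedAddCommGroup X] [NormedSpace 𝕜 X]
  [NormedAddCommGroup Y] [NormedSpace 𝕜 Y]

theorem exists_norm_one (b : SchauderBasis 𝕜 X) : ∃ b' : SchauderBasis 𝕜 X, ∀ j, ‖b' j‖ = 1 := by
  have h0 : ∀ j, ‖b j‖ ≠ 0 := fun j h => by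
    have := b.coord_basis j j
    rw [norm_eq_zero.1 h] at this
    simp at this
  have h1 : ∀ j, (‖b j‖ : 𝕜) ≠ 0 := fun j => by exact_mod_cast h0 j
  refine ⟨⟨fun j => (‖b j‖ : 𝕜)⁻¹ • b j, fun j => (‖b j‖ : 𝕜) • b.coord j, fun i j => ?_,
    fun f => ?_⟩, fun j => ?_⟩
  · rw [_root_.smul_apply, map_smul, b.ortho]
    by_cases h : i = j
    · subst h
      simp [h1 i]
    · simp [h]
  · convert b.expansion f using 2 with j
    rw [_root_.smul_apply, smul_smul, smul_eq_mul, mul_right_comm, mul_inv_cancel₀ (h1 j), one_mul]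
  · simp [norm_smul, h0 j]

theorem exists_coord_bound [CompleteSpace X] (b : SchauderBasis 𝕜 X) {c : ℝ} (hc : 0 < c)
    (hb : ∀ j, c ≤ ‖b j‖) : ∃ C : ℝ, ∀ j f, ‖b.coord j f‖ ≤ C * ‖f‖ := by
  obtain ⟨K, hK⟩ := b.exists_norm_proj_le
  refine ⟨2 * K / c, fun j f => ?_⟩
  have h1 : b.coord j f • b j = b.proj (j + 1) f - b.proj j f := by
    simp [Finset.sum_range_succ]
  have h2 : ‖b.coord j f‖ * c ≤ 2 * K * ‖f‖ := by
    calc _ ≤ ‖b.coord j f‖ * ‖b j‖ := by gcongr; exact hb j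
      _ = ‖b.proj (j + 1) f - b.proj j f‖ := by rw [← h1, norm_smul]
      _ ≤ K * ‖f‖ + K * ‖f‖ := (norm_sub_le _ _).trans
        (add_le_add ((b.proj _).le_of_opNorm_le (hK _) f) ((b.proj _).le_of_opNorm_le (hK _) f))
      _ = _ := by ring
  rw [div_mul_eq_mul_div, le_div_iff₀ hc]
  exact h2

/-- A bounded operator maps the whole space into a closed span as soon as it maps the vectors of a
basis into it. -/
theorem map_mem_of_forall_mem (b : SchauderBasis 𝕜 X) (T : X →L[𝕜] Y) {S : Set Y}
    (hS : ∀ j, T (b j) ∈ (Submodule.span 𝕜 S).topologicalClosure) (f : X) :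
    T f ∈ (Submodule.span 𝕜 S).topologicalClosure := by
  have h1 := (T.continuous.tendsto f).comp (b.tendsto_proj f)
  refine (Submodule.isClosed_topologicalClosure _).mem_of_tendsto h1
    (Filter.Eventually.of_forall fun n => ?_)
  simp only [Function.comp_apply, SetLike.mem_coe, proj_apply, map_sum, map_smul]
  exact Submodule.sum_mem _ fun i _ => Submodule.smul_mem _ _ (hS i)

/-- The interlaced union of two bases is a basis of the direct sum. -/
theorem exists_prod (b : SchauderBasis 𝕜 X) (d : SchauderBasis 𝕜 Y) :
    ∃ v : SchauderBasis 𝕜 (X × Y), ∀ k, v (2 * k) = (b k, 0) ∧ v (2 * k + 1) = (0, d k) := by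
  let x : ℕ → X × Y := fun n => if Even n then (b (n / 2), 0) else (0, d (n / 2))
  let a : ℕ → StrongDual 𝕜 (X × Y) := fun n =>
    if Even n then (b.coord (n / 2)).comp (ContinuousLinearMap.fst 𝕜 X Y)
    else (d.coord (n / 2)).comp (ContinuousLinearMap.snd 𝕜 X Y)
  have hodd : ∀ k, (2 * k + 1) / 2 = k := fun k => by omega
  have hx0 : ∀ k, x (2 * k) = (b k, 0) := fun k => by simp [x]
  have hx1 : ∀ k, x (2 * k + 1) = (0, d k) := fun k => by simp [x, hodd]
  have ha0 : ∀ k p, a (2 * k) p = b.coord k p.1 := fun k p => by simp [a]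
  have ha1 : ∀ k p, a (2 * k + 1) p = d.coord k p.2 := fun k p => by simp [a, hodd]
  have hsum : ∀ n p, ∑ i ∈ Finset.range n, a i p • x i
      = (b.proj ((n + 1) / 2) p.1, d.proj (n / 2) p.2) := by
    intro n p
    induction n with
    | zero => simp [Prod.ext_iff]
    | succ n ih =>
      rw [Finset.sum_range_succ, ih]
      rcases Nat.even_or_odd' n with ⟨k, rfl | rfl⟩
      · have h1 : (2 * k + 1 + 1) / 2 = k + 1 := by omega
        rw [hx0, ha0, h1, hodd]
        simp [Finset.sum_range_succ]
      · have h1 : (2 * k + 1 + 1) / 2 = k + 1 := by omega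
        have h2 : (2 * k + 1 + 1 + 1) / 2 = k + 1 := by omega
        rw [hx1, ha1, h1, h2, hodd]
        simp [Finset.sum_range_succ]
  refine ⟨⟨x, a, fun i j => ?_, fun p => ?_⟩, fun k => ⟨hx0 k, hx1 k⟩⟩
  · have : a i (x j) = if i = j then 1 else 0 := by
      rcases Nat.even_or_odd' i with ⟨k, rfl | rfl⟩ <;>
        rcases Nat.even_or_odd' j with ⟨l, rfl | rfl⟩
      · rw [hx0, ha0, coord_basis]
        simp
      · rw [hx1, ha0, if_neg (by omega)]
        simp
      · rw [hx0, ha1, if_neg (by omega)]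
        simp
      · rw [hx1, ha1, coord_basis]
        simp
    rw [this]
    split_ifs with h
    · subst h; simp
    · simp [h]
  · rw [HasSum, SummationFilter.conditional_filter_eq_map_range, Filter.tendsto_map'_iff]
    have h1 : Filter.Tendsto (fun n : ℕ => (n + 1) / 2) Filter.atTop Filter.atTop :=
      Filter.tendsto_atTop_atTop.2 fun k => ⟨2 * k, fun n hn => by omega⟩
    have h2 : Filter.Tendsto (fun n : ℕ => n / 2) Filter.atTop Filter.atTop :=
      Filter.tendsto_atTop_atTop.2 fun k => ⟨2 * k, fun n hn => by omega⟩
    exact (((b.tendsto_proj p.1).comp h1).prodMk_nhds ((d.tendsto_proj p.2).comp h2)).congr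
      fun n => (hsum n p).symm

theorem not_isBlockStart_of_odd {j : ℕ} (hj : Odd j) : ¬ IsBlockStart j := by
  intro h
  have h1 := blockStart_add_two (blockIndex j)
  rw [← h, pow_succ] at h1
  obtain ⟨k, rfl⟩ := hj
  omega

/-- This reindexes the unit vectors of `ℓ₁` by the non-initial indices. Those are infinitely many
because block starts are even. -/
theorem nonempty_equiv_not_isBlockStart : Nonempty ({j // ¬ IsBlockStart j} ≃ ℕ) := by
  have : Infinite {j // ¬ IsBlockStart j} :=
    Infinite.of_injective (fun n : ℕ => ⟨2 * n + 1, not_isBlockStart_of_odd ⟨n, rfl⟩⟩)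
      fun m n h => by simpa using h
  exact (nonempty_denumerable _).map fun i => i.eqv

variable {𝕜 X V : Type*} [RCLike 𝕜] [NormedAddCommGroup X] [NormedSpace 𝕜 X]
  [NormedAddCommGroup V] [NormedSpace 𝕜 V]

/-- A semi-normalized basis of `V` and the unit vectors of `ℓ₁` give a block system in `V × ℓ₁`. -/
theorem SemiNormalized.exists_blockSystem [CompleteSpace V] {v : SchauderBasis 𝕜 V}
    (hv : v.SemiNormalized) (Φ : X ≃L[𝕜] V × EllOne.Space 𝕜) :
    ∃ (v' : ℕ → StrongDual 𝕜 X) (e : ℕ → X) (e' : ℕ → StrongDual 𝕜 X) (C : ℝ),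
      BlockSystem (fun n => Φ.symm (v n, 0)) v' e e' C := by
  obtain ⟨c, C, hc, hcC⟩ := hv
  obtain ⟨C', hC'⟩ := v.exists_coord_bound hc fun j => (hcC j).1
  obtain ⟨K, hK⟩ := v.exists_norm_proj_le
  obtain ⟨ν⟩ := nonempty_equiv_not_isBlockStart
  have hK0 : 0 ≤ K := (norm_nonneg _).trans (hK 0)
  set M := ‖(Φ : X →L[𝕜] V × EllOne.Space 𝕜)‖ with hM
  set M' := ‖(Φ.symm : V × EllOne.Space 𝕜 →L[𝕜] X)‖ with hM'
  have hM0 : 0 ≤ M := norm_nonneg _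
  have hM0' : 0 ≤ M' := norm_nonneg _
  have hΦ : ∀ f, ‖Φ f‖ ≤ M * ‖f‖ := fun f =>
    (Φ : X →L[𝕜] V × EllOne.Space 𝕜).le_opNorm f
  have hΦ1 : ∀ f, ‖(Φ f).1‖ ≤ M * ‖f‖ := fun f => (norm_fst_le _).trans (hΦ f)
  have hΦ2 : ∀ f, ‖(Φ f).2‖ ≤ M * ‖f‖ := fun f => (norm_snd_le _).trans (hΦ f)
  have hΨ : ∀ p, ‖Φ.symm p‖ ≤ M' * ‖p‖ := fun p =>
    (Φ.symm : V × EllOne.Space 𝕜 →L[𝕜] X).le_opNorm p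
  -- Each summand is the bound needed for one of the estimates of `BlockSystem`.
  set D := M' * |C| + |C'| * M + M' + M + M' * (K * M) with hD
  have hD1 : 0 ≤ M' * |C| := by positivity
  have hD2 : 0 ≤ |C'| * M := by positivity
  have hD3 : 0 ≤ M' * (K * M) := by positivity
  let e : ℕ → X := fun j => if h : IsBlockStart j then 0
    else Φ.symm (0, EllOne.unitVec 𝕜 (ν ⟨j, h⟩))
  let e' : ℕ → StrongDual 𝕜 X := fun j => if h : IsBlockStart j then 0
    else (EllOne.eval 𝕜 (ν ⟨j, h⟩)).comp ((ContinuousLinearMap.snd 𝕜 _ _).comp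
      (Φ : X →L[𝕜] V × EllOne.Space 𝕜))
  let v' : ℕ → StrongDual 𝕜 X := fun n => (v.coord n).comp ((ContinuousLinearMap.fst 𝕜 _ _).comp
      (Φ : X →L[𝕜] V × EllOne.Space 𝕜))
  have he0 : ∀ j, IsBlockStart j → e j = 0 := fun j h => dif_pos h
  have he1 : ∀ j (h : ¬ IsBlockStart j), e j = Φ.symm (0, EllOne.unitVec 𝕜 (ν ⟨j, h⟩)) :=
    fun j h => dif_neg h
  have he0' : ∀ j, IsBlockStart j → e' j = 0 := fun j h => dif_pos h
  have he1' : ∀ j (h : ¬ IsBlockStart j) f, e' j f = (Φ f).2 (ν ⟨j, h⟩) := by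
    intro j h f
    simp only [e', dif_neg h]
    rfl
  have hv' : ∀ n f, v' n f = v.coord n (Φ f).1 := fun _ _ => rfl
  refine ⟨v', e, e', D, ?_, ?_, ?_, ?_, ?_, ?_, ?_, ?_, he0, he0', ?_, ?_⟩
  · intro n
    have h1 : ‖(v n, (0 : EllOne.Space 𝕜))‖ ≤ |C| := by
      simpa [Prod.norm_def] using (hcC n).2.trans (le_abs_self C)
    have h2 : ‖Φ.symm (v n, 0)‖ ≤ M' * |C| := (hΨ _).trans (by gcongr)
    linarith
  · intro n f
    have h1 : ‖v' n f‖ ≤ |C'| * (M * ‖f‖) :=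
      (hC' n _).trans (mul_le_mul (le_abs_self _) (hΦ1 f) (norm_nonneg _) (abs_nonneg _))
    refine h1.trans ?_
    rw [← mul_assoc]
    gcongr
    linarith
  · intro j
    by_cases h : IsBlockStart j
    · rw [he0 j h, norm_zero]
      linarith
    · rw [he1 j h]
      refine (hΨ _).trans ?_
      have : ‖((0 : V), EllOne.unitVec 𝕜 (ν ⟨j, h⟩))‖ = 1 := by
        simp [Prod.norm_def, EllOne.norm_unitVec]
      rw [this]
      linarith
  · intro A f
    have h1 : ∑ j ∈ A, ‖e' j f‖ = ∑ j ∈ A.subtype fun j => ¬ IsBlockStart j, ‖(Φ f).2 (ν j)‖ := by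
      rw [← Finset.sum_filter_of_ne (p := fun j => ¬ IsBlockStart j) fun j _ hj h => hj (by
        simp [he0' j h]), ← Finset.sum_subtype_eq_sum_filter]
      exact Finset.sum_congr rfl fun j _ => by rw [he1' j.1 j.2]
    have h2 := EllOne.sum_norm_le ((A.subtype fun j => ¬ IsBlockStart j).map ν.toEmbedding) (Φ f).2
    rw [Finset.sum_map] at h2
    refine (h1.trans_le h2).trans ((hΦ2 f).trans ?_)
    gcongr
    linarith
  · intro i j
    rw [hv', Φ.apply_symm_apply, coord_basis]
  · intro i j
    by_cases h : IsBlockStart j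
    · rw [he0 j h, map_zero]
    · rw [he1 j h, hv', Φ.apply_symm_apply, map_zero]
  · intro i j
    by_cases h : IsBlockStart i
    · rw [he0' i h, _root_.zero_apply]
    · rw [he1' i h, Φ.apply_symm_apply]
      rfl
  · intro i j hi
    by_cases h : IsBlockStart j
    · have : i ≠ j := fun hij => hi (hij ▸ h)
      rw [he0 j h, map_zero, if_neg this]
    · rw [he1 j h, he1' i hi, Φ.apply_symm_apply, ← EllOne.eval_apply, EllOne.eval_unitVec]
      simp
  · intro n f
    have h1 : ∑ k ∈ Finset.range n, v' k f • Φ.symm (v k, 0) = Φ.symm (v.proj n (Φ f).1, 0) := by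
      have : (v.proj n (Φ f).1, (0 : EllOne.Space 𝕜))
          = ContinuousLinearMap.inl 𝕜 V (EllOne.Space 𝕜) (v.proj n (Φ f).1) := rfl
      rw [this, proj_apply, map_sum, map_sum]
      refine Finset.sum_congr rfl fun k _ => ?_
      rw [map_smul, map_smul, hv']
      rfl
    rw [h1]
    have h2 : ‖(v.proj n (Φ f).1, (0 : EllOne.Space 𝕜))‖ ≤ K * (M * ‖f‖) := by
      have := ((v.proj n).le_of_opNorm_le (hK n) (Φ f).1).trans
        (mul_le_mul_of_nonneg_left (hΦ1 f) hK0)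
      simpa only [Prod.norm_def, norm_zero, max_eq_left (norm_nonneg _)] using this
    refine ((hΨ _).trans (mul_le_mul_of_nonneg_left h2 hM0')).trans ?_
    rw [← mul_assoc K, ← mul_assoc]
    gcongr
    linarith
  · intro f
    set S := Set.range (fun n => Φ.symm (v n, 0)) ∪ Set.range e with hS
    have h1 : Φ.symm ((Φ f).1, 0) ∈ (Submodule.span 𝕜 S).topologicalClosure := by
      refine v.map_mem_of_forall_mem ((Φ.symm : V × EllOne.Space 𝕜 →L[𝕜] X).comp
        (ContinuousLinearMap.inl 𝕜 _ _)) (fun j => ?_) (Φ f).1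
      exact Submodule.le_topologicalClosure _ (Submodule.subset_span (Or.inl ⟨j, rfl⟩))
    have h2 : Φ.symm (0, (Φ f).2) ∈ (Submodule.span 𝕜 S).topologicalClosure := by
      have h3 := (EllOne.hasSum_unitVec (Φ f).2).mapL
        ((Φ.symm : V × EllOne.Space 𝕜 →L[𝕜] X).comp (ContinuousLinearMap.inr 𝕜 _ _))
      refine (Submodule.isClosed_topologicalClosure _).mem_of_tendsto h3
        (Filter.Eventually.of_forall fun A => ?_)
      refine Submodule.sum_mem _ fun i _ => ?_
      rw [map_smul]
      refine Submodule.smul_mem _ _ (Submodule.le_topologicalClosure _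
        (Submodule.subset_span (Or.inr ⟨(ν.symm i).1, ?_⟩)))
      rw [he1 _ (ν.symm i).2, Subtype.coe_eta, ν.apply_symm_apply]
      rfl
    have h3 : f = Φ.symm ((Φ f).1, 0) + Φ.symm (0, (Φ f).2) := by
      rw [← map_add, Prod.mk_add_mk, add_zero, zero_add, Prod.mk.eta, Φ.symm_apply_apply]
    rw [h3]
    exact Submodule.add_mem _ h1 h2

end SchauderBasis

/-! ### The main theorem -/

theorem theorem4p11 {𝕜 : Type*} [RCLike 𝕜] {X : Type*} [NormedAddCommGroup X] [NormedSpace 𝕜 X]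
    [CompleteSpace X] (hbasis : Nonempty (SchauderBasis 𝕜 X))
    (hl1 : IsomorphicToComplemented 𝕜 (lp (fun _ : ℕ => 𝕜) 1) X) :
    ∃ b : SchauderBasis 𝕜 X,
      b.SemiNormalized ∧
      b.AlmostGreedy ∧
      EquivalentOn {m : ℕ | 1 ≤ m} b.fundamentalFunction (fun m => (m : ℝ≥0∞)) ∧
      EquivalentOn {m : ℕ | 2 ≤ m} b.condConst (fun m => ENNReal.ofReal (Real.log m)) := by
  obtain ⟨b₀⟩ := hbasis
  obtain ⟨b₁, hb₁⟩ := b₀.exists_norm_one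
  obtain ⟨d, hd⟩ := EllOne.exists_diffBasis (𝕜 := 𝕜)
  obtain ⟨v, hv⟩ := b₁.exists_prod d
  obtain ⟨φ⟩ := EllOne.nonempty_equiv_prod_of_complemented hl1
  -- The inner copy of `ℓ₁` carries the conditional basis, the outer one the unit vectors that fill
  -- the blocks.
  let Φ : X ≃L[𝕜] (X × EllOne.Space 𝕜) × EllOne.Space 𝕜 :=
    φ.trans (φ.prodCongr (ContinuousLinearEquiv.refl 𝕜 _))
  have hvs : v.SemiNormalized := by
    refine ⟨1, 2, one_pos, fun j => ?_⟩
    rcases Nat.even_or_odd' j with ⟨k, rfl | rfl⟩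
    · simp [(hv k).1, Prod.norm_def, hb₁]
    · have h1 := EllOne.one_le_norm_diffVec (𝕜 := 𝕜) k
      have h2 := EllOne.norm_diffVec_le (𝕜 := 𝕜) k
      simp [(hv k).2, Prod.norm_def, hd, h1, h2]
  obtain ⟨v', e, e', C, hsys⟩ := hvs.exists_blockSystem Φ
  obtain ⟨b, hb, hbv⟩ := hsys.exists_basis
  set M := ‖(Φ : X →L[𝕜] (X × EllOne.Space 𝕜) × EllOne.Space 𝕜)‖
  set M' := ‖(Φ.symm : (X × EllOne.Space 𝕜) × EllOne.Space 𝕜 →L[𝕜] X)‖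
  have hM0 : 0 ≤ M := norm_nonneg _
  have hM0' : 0 ≤ M' := norm_nonneg _
  have hsum : ∀ (s : Finset ℕ) (g : ℕ → ℕ) (hg : Function.Injective g),
      ∑ n ∈ s.map (⟨g, hg⟩ : ℕ ↪ ℕ), Φ.symm (v n, 0) = Φ.symm (∑ i ∈ s, v (g i), 0) := by
    intro s g hg
    rw [Finset.sum_map, ← map_sum]
    congr 1
    ext <;> simp [Prod.fst_sum, Prod.snd_sum]
  have hodd : ∀ (s : Finset ℕ) (g : ℕ → ℕ), ∑ i ∈ s, v (2 * g i + 1)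
      = (0, ∑ i ∈ s, EllOne.diffVec 𝕜 (g i)) := by
    intro s g
    simp only [(hv _).2, hd]
    ext <;> simp [Prod.fst_sum, Prod.snd_sum]
  have hcond : ∀ k : ℕ, ENNReal.ofReal (((M + 1) * (M' + 1))⁻¹ * k)
      ≤ b.condConst (2 ^ (4 * k + 1)) := by
    intro k
    rcases Nat.eq_zero_or_pos k with rfl | hk
    · simp
    have hinj1 : Function.Injective fun i : ℕ => 2 * i + 1 := fun i j h => by
      simpa using h
    have hinj2 : Function.Injective fun i : ℕ => 2 * (2 * i) + 1 := fun i j h => by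
      simpa using h
    have hk' : (0 : ℝ) < k := by exact_mod_cast hk
    -- `A` selects the first `2 * k` difference vectors, whose sum telescopes to a unit vector; `B`
    -- keeps the even-indexed ones among them. Differences sit at odd positions of `v`, so all
    -- indices are below `4 * k`. The added ones keep the denominators positive.
    have h1 := b.le_condConst_of_sum_block hbv (c := k / (M + 1)) (D := M' + 1) (K := 4 * k)
      (A := (Finset.range (2 * k)).map ⟨_, hinj1⟩) (B := (Finset.range k).map ⟨_, hinj2⟩)
      (by positivity) ?_ ?_ ?_ ?_
    · refine le_of_eq_of_le ?_ h1
      congr 1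
      field_simp
    · intro n hn
      simp only [Finset.mem_map, Finset.mem_range, Function.Embedding.coeFn_mk] at hn ⊢
      omega
    · intro n hn
      simp only [Finset.mem_map, Finset.mem_range, Function.Embedding.coeFn_mk] at hn ⊢
      obtain ⟨i, hi, rfl⟩ := hn
      exact ⟨2 * i, by omega, rfl⟩
    · rw [hsum, hodd _ fun i => i]
      obtain ⟨l, hl⟩ : ∃ l, 2 * k = l + 1 := ⟨2 * k - 1, by omega⟩
      rw [hl, EllOne.sum_range_diffVec]
      refine ((Φ.symm : (X × EllOne.Space 𝕜) × EllOne.Space 𝕜 →L[𝕜] X).le_opNorm _).trans ?_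
      simp only [Prod.norm_def, norm_zero, EllOne.norm_unitVec]
      norm_num
      change M' ≤ M' + 1
      linarith
    · rw [hsum, hodd _ fun i => 2 * i, div_le_iff₀ (by positivity)]
      set y := ∑ i ∈ Finset.range k, EllOne.diffVec 𝕜 (2 * i) with hy
      have h2 := (Φ : X →L[𝕜] (X × EllOne.Space 𝕜) × EllOne.Space 𝕜).le_opNorm
        (Φ.symm (((0 : X), y), (0 : EllOne.Space 𝕜)))
      rw [ContinuousLinearEquiv.coe_coe, Φ.apply_symm_apply] at h2
      have h3 : ‖y‖ ≤ ‖(((0 : X), y), (0 : EllOne.Space 𝕜))‖ := by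
        simp [Prod.norm_def]
      have h4 := EllOne.le_norm_sum_diffVec (𝕜 := 𝕜) k
      have h5 := norm_nonneg (Φ.symm (((0 : X), y), (0 : EllOne.Space 𝕜)))
      change _ ≤ M * _ at h2
      linarith
  exact ⟨b, hb.semiNormalized, hb.almostGreedy, hb.fundamentalFunction_equivalent _,
    hb.condConst_dominated_log, b.log_dominated_condConst (by positivity) hcond⟩
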